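/- Fix $n$. A stable $n$-labeled tree $G$ is a tree with finite nonempty set $V(G)$ of internal vertices and $n$ leaves labeled by $[n]=\{1,\dots,n\}$, each attached to an internal vertex, such that every internal vertex has at least $3$ adjacent edges (leaves included). A contraction $\pi: G\rightsquigarrow G'$ collapses pairwise disjoint connected sets of internal vertices to single vertices, keeping the labels; we also write $\pi:V(G)\to V(G')$ for the induced surjection. An assignment $Z$ is a choice of a subset $Z(G)\subseteq V(G)$ for every stable $n$-labeled tree $G$; inclusions and unions of assignments are taken tree by tree. $Z$ is extremal if $Z(G)\neq V(G)$ for all $G$ and, for every contraction $\pi:G\rightsquigarrow G'$ and $v'\in V(G')$, one has $v'\in Z(G')$ if and only if $\pi^{-1}(v')\subseteq Z(G)$. A basic pair $(G,v)$ is a stable $n$-labeled tree $G$ with at least two internal vertices in which every internal vertex other than $v$ is adjacent to $v$. Its set partition of $[n]$ consists of the singletons $\{i\}$ for the labels $i$ at $v$ and, for each internal vertex $w\ne v$, the set of labels at $w$. The atomic extremal assignment generated by $(G,v)$ is the smallest extremal assignment $Z$ with $v\in Z(G)$; an assignment is atomic if it is generated in this way by some basic pair. For a set partition $Q$ of $[n]$,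 let $Z_Q(H)$ be the set of $w\in V(H)$ such that there are a basic pair $(G,v)$ with set partition $Q$ and a contraction $\pi:H\rightsquigarrow G$ with $\pi(w)=v$. For set partitions of $[n]$ write $P\le Q$ if every block of $Q$ is contained in a block of $P$, and $P\preceq Q$ if moreover no block of $P$ with at least two elements is a union of singleton blocks of $Q$. A tight common upper bound of $Q_1$ and $Q_2$ is a set partition $R$ with $Q_1\le R$, $Q_2\le R$, each of whose blocks is a block of $Q_1$ or of $Q_2$. **Theorem.** (1) The basic pairs have exactly the set partitions $P$ of $[n]$ with $3\le |P|\le n-1$ as their set partitions, and there is a bijection $P\mapsto A_P$ from the set of these $P$ onto the set of atomic extremal assignments such that $A_P$ is the atomic extremal assignment generated by $(G,v)$ for every basic pair $(G,v)$ with set partition $P$. Explicitly, $A_P=\bigcup_{Q\preceq P,\ |Q|\ge 3} Z_Q$. (2) Every extremal assignment is a union of finitely many (possibly zero) atomic extremal assignments. (3) Let $P_1,\dots,P_k$ be set partitions of $[n]$ with $3\le|P_i|\le n-1$. The union $\bigcup_{i=1}^k A_{P_i}$ is extremal if and only if for all $i,j\in\{1,\dots,k\}$, all $Q_1\preceq P_i$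 and $Q_2\preceq P_j$, and every tight common upper bound $R$ of $Q_1$ and $Q_2$, there is $\ell$ with $R\le P_\ell$. -/

import Mathlib

namespace ExtremalAssignment

/-- A stable `n`-labeled tree. `V` is the finite set of internal vertices, `graph` the tree that
they span, and `label i` the internal vertex that carries the leaf `i`. Every internal vertex has
at least three adjacent edges, leaves included. -/
structure StableTree (n : ℕ) where
  /-- the internal vertices -/
  V : Type
  [finite_V : Finite V]
  /-- the edges between internal vertices -/
  graph : SimpleGraph V
  isTree : graph.IsTree
  /-- the internal vertex that the leaf `i` is attached to -/
  label : Fin n → V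
  stable : ∀ v : V, 3 ≤ (graph.neighborSet v).ncard + {i : Fin n | label i = v}.ncard

attribute [instance] StableTree.finite_V

/-- A contraction from `G` to `G'`, given by its map on internal vertices: every vertex of `G'`
arises by collapsing a nonempty connected set of vertices of `G` (so the map is onto), the labels
are kept, and the edges of `G'` are those edges of `G` that are not collapsed.
The identity and all isomorphisms of labeled trees are contractions. -/
structure Contraction {n : ℕ} (G G' : StableTree n) where
  toFun : G.V → G'.V
  map_label : ∀ i : Fin n, toFun (G.label i) = G'.label i
  fiber_connected : ∀ v' : G'.V, (G.graph.induce {v : G.V | toFun v = v'}).Connected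
  adj_iff : ∀ v' w' : G'.V, G'.graph.Adj v' w' ↔
    v' ≠ w' ∧ ∃ v w : G.V, toFun v = v' ∧ toFun w = w' ∧ G.graph.Adj v w

/-- An assignment: a set of internal vertices of every stable `n`-labeled tree. Assignments are
ordered by inclusion, tree by tree. -/
abbrev Assignment (n : ℕ) : Type 1 := (G : StableTree n) → Set G.V

/-- Extremal assignments of order `n`. -/
structure IsExtremal {n : ℕ} (Z : Assignment n) : Prop where
  ne_univ : ∀ G : StableTree n, Z G ≠ Set.univ
  mem_iff : ∀ (G G' : StableTree n) (π : Contraction G G') (v' : G'.V),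
    v' ∈ Z G' ↔ ∀ v : G.V, π.toFun v = v' → v ∈ Z G

/-- The union of a family of assignments, tree by tree. -/
def union {n : ℕ} {ι : Type*} (Z : ι → Assignment n) : Assignment n :=
  fun G => ⋃ i, Z i G

/-- `(G, v)` is a basic pair: `G` has more than one internal vertex and is a star with central
vertex `v`. -/
def IsBasicPair {n : ℕ} (G : StableTree n) (v : G.V) : Prop :=
  Nontrivial G.V ∧ ∀ w : G.V, w ≠ v → G.graph.Adj v w

/-- Set partitions of the label set. -/
abbrev SetPartition (n : ℕ) : Type := Finpartition (Finset.univ : Finset (Fin n))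

open Classical in
/-- `P` is the set partition of the basic pair `(G, v)`. Its blocks are the label sets of the tails
at `v`: a singleton for each label at `v` itself, and the set of labels at `w` for each other
internal vertex `w`. -/
def IsPartitionOf {n : ℕ} (P : SetPartition n) (G : StableTree n) (v : G.V) : Prop :=
  ∀ B : Finset (Fin n), B ∈ P.parts ↔
    (∃ i : Fin n, G.label i = v ∧ B = {i}) ∨
      ∃ w : G.V, w ≠ v ∧ B = Finset.univ.filter (fun i => G.label i = w)

/-- `P ≤ Q` in the order of the text, where the finer partition is the larger one: every block of
`Q` lies in a block of `P`. (The order of Mathlib on `Finpartition` is the opposite one.) -/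
def Le {n : ℕ} (P Q : SetPartition n) : Prop :=
  ∀ C ∈ Q.parts, ∃ B ∈ P.parts, C ⊆ B

/-- `P ⪯ Q`: moreover no block of `P` with at least two elements is a union of singleton blocks
of `Q`. -/
def CurlyLe {n : ℕ} (P Q : SetPartition n) : Prop :=
  Le P Q ∧ ∀ B ∈ P.parts, 2 ≤ B.card → ¬ ∀ i ∈ B, {i} ∈ Q.parts

/-- `R` is a tight common upper bound of `P` and `Q`. -/
def IsTightUpperBound {n : ℕ} (P Q R : SetPartition n) : Prop :=
  Le P R ∧ Le Q R ∧ ∀ B ∈ R.parts, B ∈ P.parts ∨ B ∈ Q.parts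

/-- The assignment `Z_P` generated by the basic pair of `P` (which is unique up to isomorphism):
the vertices of `H` that go to the central vertex under a contraction to that star. -/
def generated {n : ℕ} (P : SetPartition n) : Assignment n :=
  fun H => {w : H.V | ∃ (G : StableTree n) (v : G.V), IsBasicPair G v ∧ IsPartitionOf P G v ∧
    ∃ π : Contraction H G, π.toFun w = v}

/-- `Z` is the atomic extremal assignment generated by `(G, v)`: the smallest extremal assignment
in which the vertex `v` of `G` is assigned. -/
def IsAtomicOf {n : ℕ} (Z : Assignment n) (G : StableTree n) (v : G.V) : Prop :=
  IsLeast {Z' : Assignment n | IsExtremal Z' ∧ v ∈ Z' G} Z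

/-- Atomic extremal assignments: those generated by some basic pair. -/
def IsAtomicAssignment {n : ℕ} (Z : Assignment n) : Prop :=
  ∃ (G : StableTree n) (v : G.V), IsBasicPair G v ∧ IsAtomicOf Z G v

/-- Set partitions with at least three and at most `n - 1` blocks. -/
abbrev BasicPartition (n : ℕ) : Type :=
  {P : SetPartition n // 3 ≤ P.parts.card ∧ P.parts.card ≤ n - 1}

end ExtremalAssignment

open ExtremalAssignment

/-! Deleting a vertex `v` from `G` partitions the labels, with labels at `v` as singletons; `sep G
{v}` is this relation, and `sep G S` its analogue for a set `S` of vertices. A finer partition is a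
smaller relation. Two facts govern everything. In a tree, a set separates two labels only if one of
its vertices does (`sep_of_forall`), and a contraction satisfies `sep G (π⁻¹ A) = sep G' A`
(`Contraction.sep_preimage`).

An extremal `Z` sees only the partition at a vertex, because contracting the branches at `v` has
fibre `{v}` over the centre of the star (`toStar`, `IsExtremal.mem_iff_center`). Moreover `Z` is
closed under coarsening (`IsExtremal.mem_of_sep_le`): a tree built from the nonsingleton blocks of a
partition and of a refinement has the coarse partition at its top vertex, which goes to the centre
of the refined star under a contraction. Hence the least extremal assignment containing a vertex
with partition `P` is `atomic P`, the set of all vertices with partition coarser than `P`, and every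
extremal `Z` is a union of these.

For a union, the point is that a connected set `S` of assigned vertices must satisfy `rel (P l) ≤
sep G S` for a single `l` (`IsTightClosed.exists_le_sep`). Let `S` grow along an edge: the labels
beyond the edge form one class of the old relation, the others one class of the new vertex, so the
meet of the two is, after refinement, a tight upper bound (`IsTightClosed.exists_le_inf`).
Conversely, every tight upper bound is realized by a contraction onto a star
(`isTightClosed_of_isExtremal`). -/

namespace ExtremalAssignment

/-! ### Set partitions as equivalence relations -/

section Partitions

variable {n : ℕ}

/-- The equivalence relation of a set partition. -/
def rel (P : SetPartition n) : Setoid (Fin n) := Setoid.ker P.part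

theorem part_mem_parts (P : SetPartition n) (i : Fin n) : P.part i ∈ P.parts :=
  P.part_mem.2 (Finset.mem_univ i)

theorem mem_part_self (P : SetPartition n) (i : Fin n) : i ∈ P.part i :=
  P.mem_part_self.2 (Finset.mem_univ i)

theorem part_eq {P : SetPartition n} {B : Finset (Fin n)} {i : Fin n} (hB : B ∈ P.parts)
    (hi : i ∈ B) : P.part i = B :=
  P.part_eq_of_mem hB hi

theorem rel_iff_mem {P : SetPartition n} {i j : Fin n} : rel P i j ↔ j ∈ P.part i := by
  refine ⟨fun h => ?_, fun h => (part_eq (part_mem_parts P i) h).symm⟩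
  have h' : P.part i = P.part j := h
  exact h' ▸ mem_part_self P j

theorem rel_of_mem {P : SetPartition n} {B : Finset (Fin n)} {i j : Fin n} (hB : B ∈ P.parts)
    (hi : i ∈ B) (hj : j ∈ B) : rel P i j :=
  rel_iff_mem.2 (part_eq hB hi ▸ hj)

theorem mem_of_rel {P : SetPartition n} {B : Finset (Fin n)} {i j : Fin n} (hB : B ∈ P.parts)
    (hi : i ∈ B) (h : rel P i j) : j ∈ B :=
  part_eq hB hi ▸ rel_iff_mem.1 h

theorem exists_mem_of_mem_parts {P : SetPartition n} {B : Finset (Fin n)} (hB : B ∈ P.parts) :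
    ∃ i, i ∈ B :=
  P.nonempty_of_mem_parts hB

/-- The order turns around: the larger partition for `Le` is the finer one and has the smaller
relation. -/
theorem le_iff {P Q : SetPartition n} : Le P Q ↔ rel Q ≤ rel P := by
  constructor
  · intro h i j hij
    obtain ⟨B, hB, hC⟩ := h _ (part_mem_parts Q i)
    exact rel_of_mem hB (hC (mem_part_self Q i)) (hC (rel_iff_mem.1 hij))
  · intro h C hC
    obtain ⟨i, hi⟩ := exists_mem_of_mem_parts hC
    exact ⟨P.part i, part_mem_parts P i, fun j hj => rel_iff_mem.1 (h (rel_of_mem hC hi hj))⟩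

theorem rel_injective {P Q : SetPartition n} (h : rel P = rel Q) : P = Q := by
  have hp : ∀ i, P.part i = Q.part i := fun i => by
    ext j
    rw [← rel_iff_mem, ← rel_iff_mem, h]
  ext B
  constructor
  · intro hB
    obtain ⟨i, hi⟩ := exists_mem_of_mem_parts hB
    rw [← part_eq hB hi, hp]
    exact part_mem_parts Q i
  · intro hB
    obtain ⟨i, hi⟩ := exists_mem_of_mem_parts hB
    rw [← part_eq hB hi, ← hp]
    exact part_mem_parts P i

open Classical in
/-- The set partition into the classes of an equivalence relation. -/
noncomputable def classes (s : Setoid (Fin n)) : SetPartition n := Finpartition.ofSetoid s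

theorem rel_classes (s : Setoid (Fin n)) : rel (classes s) = s := by
  classical
  ext i j
  rw [rel_iff_mem]
  unfold classes
  convert Finpartition.mem_part_ofSetoid_iff_rel (s := s) (a := i) (b := j)

/-- There are at least three classes. -/
def HasThree (s : Setoid (Fin n)) : Prop := ∃ a b c, ¬ s a b ∧ ¬ s a c ∧ ¬ s b c

theorem HasThree.mono {s t : Setoid (Fin n)} (h : HasThree t) (hst : s ≤ t) : HasThree s := by
  obtain ⟨a, b, c, h₁, h₂, h₃⟩ := h
  exact ⟨a, b, c, fun h => h₁ (hst h), fun h => h₂ (hst h), fun h => h₃ (hst h)⟩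

theorem three_le_card_iff {P : SetPartition n} : 3 ≤ P.parts.card ↔ HasThree (rel P) := by
  rw [show 3 ≤ P.parts.card ↔ 2 < P.parts.card from Iff.rfl, Finset.two_lt_card]
  constructor
  · rintro ⟨A, hA, B, hB, C, hC, h₁, h₂, h₃⟩
    obtain ⟨a, ha⟩ := exists_mem_of_mem_parts hA
    obtain ⟨b, hb⟩ := exists_mem_of_mem_parts hB
    obtain ⟨c, hc⟩ := exists_mem_of_mem_parts hC
    refine ⟨a, b, c, fun h => h₁ ?_, fun h => h₂ ?_, fun h => h₃ ?_⟩
    · rw [← part_eq hA ha, ← part_eq hB hb]; exact h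
    · rw [← part_eq hA ha, ← part_eq hC hc]; exact h
    · rw [← part_eq hB hb, ← part_eq hC hc]; exact h
  · rintro ⟨a, b, c, h₁, h₂, h₃⟩
    exact ⟨_, part_mem_parts P a, _, part_mem_parts P b, _, part_mem_parts P c, h₁, h₂, h₃⟩

/-- Some class has two elements. -/
def NonDiscrete (s : Setoid (Fin n)) : Prop := ∃ i j, i ≠ j ∧ s i j

theorem NonDiscrete.mono {s t : Setoid (Fin n)} (h : NonDiscrete s) (hst : s ≤ t) :
    NonDiscrete t := by
  obtain ⟨i, j, hij, h⟩ := h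
  exact ⟨i, j, hij, hst h⟩

theorem card_le_pred_iff {P : SetPartition n} (h3 : 3 ≤ P.parts.card) :
    P.parts.card ≤ n - 1 ↔ NonDiscrete (rel P) := by
  have him : Finset.univ.image P.part = P.parts := by
    ext B
    simp only [Finset.mem_image, Finset.mem_univ, true_and]
    constructor
    · rintro ⟨i, rfl⟩
      exact part_mem_parts P i
    · intro hB
      obtain ⟨i, hi⟩ := exists_mem_of_mem_parts hB
      exact ⟨i, part_eq hB hi⟩
  have hle : P.parts.card ≤ n := by
    simpa using P.card_parts_le_card
  have hinj : P.parts.card = n ↔ Function.Injective P.part := by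
    simpa [him, Set.injOn_univ] using Finset.card_image_iff (s := Finset.univ) (f := P.part)
  -- The bound `h3` forces `3 ≤ n`, so the truncated subtraction does no harm.
  have : P.parts.card ≤ n - 1 ↔ ¬ P.parts.card = n := by omega
  rw [this, hinj, Function.Injective]
  push Not
  constructor
  · rintro ⟨i, j, h, hij⟩
    exact ⟨i, j, hij, h⟩
  · rintro ⟨i, j, hij, h⟩
    exact ⟨i, j, h, hij⟩

/-- `CurlyLe` in terms of equivalence relations. -/
theorem curlyLe_iff {P Q : SetPartition n} : CurlyLe P Q ↔ rel Q ≤ rel P ∧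
    ∀ a b, a ≠ b → rel P a b → ∃ c d, rel P a c ∧ c ≠ d ∧ rel Q c d := by
  unfold CurlyLe
  rw [le_iff]
  refine and_congr_right fun _ => ⟨fun h a b hab hr => ?_, fun h B hB hc hs => ?_⟩
  · by_contra! hn
    refine h (P.part a) (part_mem_parts P a) ?_ ?_
    · exact Finset.one_lt_card.2 ⟨a, mem_part_self P a, b, rel_iff_mem.1 hr, hab⟩
    · intro i hi
      have : Q.part i = {i} := by
        refine Finset.eq_singleton_iff_unique_mem.2 ⟨mem_part_self Q i, fun d hd => ?_⟩
        by_contra hid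
        exact hn i d (rel_iff_mem.2 hi) (fun h => hid h.symm) (rel_iff_mem.2 hd)
      exact this ▸ part_mem_parts Q i
  · obtain ⟨a, ha, b, hb, hab⟩ := Finset.one_lt_card.1 hc
    obtain ⟨c, d, hac, hcd, hr⟩ := h a b hab (rel_of_mem hB ha hb)
    have := mem_of_rel (hs c (mem_of_rel hB ha hac)) (Finset.mem_singleton_self c) hr
    exact hcd (Finset.mem_singleton.1 this).symm

theorem isTightUpperBound_iff {P Q R : SetPartition n} : IsTightUpperBound P Q R ↔
    rel R ≤ rel P ∧ rel R ≤ rel Q ∧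
      ∀ a, (∀ b, rel P a b → rel R a b) ∨ ∀ b, rel Q a b → rel R a b := by
  unfold IsTightUpperBound
  rw [le_iff, le_iff]
  refine and_congr_right fun hP => and_congr_right fun hQ => ⟨fun h a => ?_, fun h B hB => ?_⟩
  · refine (h _ (part_mem_parts R a)).imp (fun h b hb => ?_) fun h b hb => ?_
    · exact rel_iff_mem.2 (mem_of_rel h (mem_part_self R a) hb)
    · exact rel_iff_mem.2 (mem_of_rel h (mem_part_self R a) hb)
  · obtain ⟨a, ha⟩ := exists_mem_of_mem_parts hB
    refine (h a).imp (fun h => ?_) fun h => ?_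
    · have : B = P.part a := by
        ext b
        rw [← rel_iff_mem]
        exact ⟨fun hb => hP (rel_of_mem hB ha hb), fun hb => mem_of_rel hB ha (h b hb)⟩
      exact this ▸ part_mem_parts P a
    · have : B = Q.part a := by
        ext b
        rw [← rel_iff_mem]
        exact ⟨fun hb => hQ (rel_of_mem hB ha hb), fun hb => mem_of_rel hB ha (h b hb)⟩
      exact this ▸ part_mem_parts Q a

/-- Break up those classes of `s` on which `t` is trivial. -/
def refineBy (s t : Setoid (Fin n)) : Setoid (Fin n) where
  r a b := a = b ∨ s a b ∧ ∃ c d, s a c ∧ c ≠ d ∧ t c d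
  iseqv := by
    refine ⟨fun a => Or.inl rfl, ?_, ?_⟩
    · rintro a b (rfl | ⟨h, c, d, hc, hcd, ht⟩)
      · exact Or.inl rfl
      · exact Or.inr ⟨s.symm h, c, d, s.trans (s.symm h) hc, hcd, ht⟩
    · rintro a b e (rfl | ⟨h, c, d, hc, hcd, ht⟩) (rfl | ⟨h', c', d', hc', hcd', ht'⟩)
      · exact Or.inl rfl
      · exact Or.inr ⟨h', c', d', hc', hcd', ht'⟩
      · exact Or.inr ⟨h, c, d, hc, hcd, ht⟩
      · exact Or.inr ⟨s.trans h h', c, d, hc, hcd, ht⟩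

theorem refineBy_le (s t : Setoid (Fin n)) : refineBy s t ≤ s := by
  rintro a b (rfl | ⟨h, -⟩)
  · exact s.refl a
  · exact h

theorem le_refineBy {s t : Setoid (Fin n)} (h : t ≤ s) : t ≤ refineBy s t := by
  intro a b hab
  by_cases he : a = b
  · exact Or.inl he
  · exact Or.inr ⟨h hab, a, b, s.refl a, he, hab⟩

/-- Every nonsingleton class that survives contains a nontrivial pair of `P`, which is what
`CurlyLe` demands. This turns any coarsening of `P` into a partition the criterion applies to. -/
theorem curlyLe_refineBy {s : Setoid (Fin n)} {P : SetPartition n} (h : rel P ≤ s) :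
    CurlyLe (classes (refineBy s (rel P))) P := by
  rw [curlyLe_iff, rel_classes]
  refine ⟨le_refineBy h, ?_⟩
  rintro a b hab (rfl | ⟨h, c, d, hc, hcd, ht⟩)
  · exact (hab rfl).elim
  · exact ⟨c, d, Or.inr ⟨hc, c, d, hc, hcd, ht⟩, hcd, ht⟩

/-- The criterion on a family of set partitions in the third part of the theorem. -/
def IsTightClosed {ι : Type*} (P : ι → SetPartition n) : Prop :=
  ∀ (i j : ι) (Q₁ Q₂ R : SetPartition n), CurlyLe Q₁ (P i) → CurlyLe Q₂ (P j) →
    IsTightUpperBound Q₁ Q₂ R → ∃ l, Le R (P l)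

/-- If `B` is a class of `s` and its complement is a class of `t`, the criterion applies to the
intersection of `s` and `t`. -/
theorem IsTightClosed.exists_le_inf {ι : Type*} {P : ι → SetPartition n} (hP : IsTightClosed P)
    {i j : ι} {s t : Setoid (Fin n)} (hs : rel (P i) ≤ s) (ht : rel (P j) ≤ t) (B : Set (Fin n))
    (hsB : ∀ a ∈ B, ∀ b, s a b ↔ b ∈ B) (htB : ∀ a ∉ B, ∀ b, t a b ↔ b ∉ B) :
    ∃ l, rel (P l) ≤ s ⊓ t := by
  -- If `P i` is trivial on `B`, all its nontrivial pairs lie in the complement, a single class of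
  -- `t`; then `l = i` works. Symmetrically for `P j` off `B`.
  by_cases h₁ : ∃ c ∈ B, ∃ d, c ≠ d ∧ rel (P i) c d
  swap
  · push Not at h₁
    refine ⟨i, fun a b hab => ⟨hs hab, ?_⟩⟩
    by_cases ha : a ∈ B
    · by_cases he : a = b
      · exact he ▸ t.refl a
      · exact (h₁ a ha b he hab).elim
    · by_cases hb : b ∈ B
      · exact (h₁ b hb a (fun h => ha (h ▸ hb)) ((rel (P i)).symm hab)).elim
      · exact (htB a ha b).2 hb
  by_cases h₂ : ∃ c ∉ B, ∃ d, c ≠ d ∧ rel (P j) c d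
  swap
  · push Not at h₂
    refine ⟨j, fun a b hab => ⟨?_, ht hab⟩⟩
    by_cases ha : a ∈ B
    · by_cases hb : b ∈ B
      · exact (hsB a ha b).2 hb
      · exact (h₂ b hb a (fun h => hb (h ▸ ha)) ((rel (P j)).symm hab)).elim
    · by_cases he : a = b
      · exact he ▸ s.refl a
      · exact (h₂ a ha b he hab).elim
  obtain ⟨c₁, hc₁, d₁, hcd₁, hr₁⟩ := h₁
  obtain ⟨c₂, hc₂, d₂, hcd₂, hr₂⟩ := h₂
  -- Now `B` survives in the refinement of `s` and its complement in that of `t`. So the meet has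
  -- the blocks of the second refinement inside `B` and those of the first outside: it is tight.
  obtain ⟨l, hl⟩ := hP i j _ _ (classes (refineBy s (rel (P i)) ⊓ refineBy t (rel (P j))))
    (curlyLe_refineBy hs) (curlyLe_refineBy ht) (by
      rw [isTightUpperBound_iff]
      rw [rel_classes, rel_classes, rel_classes]
      refine ⟨inf_le_left, inf_le_right, fun a => ?_⟩
      by_cases ha : a ∈ B
      · right
        intro b hb
        have hbt := refineBy_le _ _ hb
        have hbB : b ∈ B := by
          by_contra hbB
          exact (htB b hbB a).1 (t.symm hbt) ha
        exact ⟨Or.inr ⟨(hsB a ha b).2 hbB, c₁, d₁, (hsB a ha c₁).2 hc₁, hcd₁, hr₁⟩, hb⟩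
      · left
        intro b hb
        have hbs := refineBy_le _ _ hb
        have hbB : b ∉ B := fun hbB => ha ((hsB b hbB a).1 (s.symm hbs))
        exact ⟨hb, Or.inr ⟨(htB a ha b).2 hbB, c₂, d₂, (htB a ha c₂).2 hc₂, hcd₂, hr₂⟩⟩)
  rw [le_iff, rel_classes] at hl
  exact ⟨l, hl.trans (inf_le_inf (refineBy_le _ _) (refineBy_le _ _))⟩

end Partitions

/-! ### Connectivity inside a vertex set of a tree -/

section Graphs

variable {V : Type*}

/-- The subgraph of the edges with both ends in `A`. -/
def within (G : SimpleGraph V) (A : Set V) : SimpleGraph V where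
  Adj x y := G.Adj x y ∧ x ∈ A ∧ y ∈ A
  symm := ⟨fun _ _ h => ⟨h.1.symm, h.2.2, h.2.1⟩⟩
  loopless := ⟨fun x h => G.loopless.irrefl x h.1⟩

variable {G : SimpleGraph V} {A B : Set V} {x y z : V}

theorem within_mono (h : A ⊆ B) : within G A ≤ within G B :=
  fun _ _ hxy => ⟨hxy.1, h hxy.2.1, h hxy.2.2⟩

theorem mem_of_reachable_within (h : (within G A).Reachable x y) (hx : x ∈ A) : y ∈ A := by
  obtain ⟨w⟩ := h
  induction w with
  | nil => exact hx
  | cons h _ ih => exact ih h.2.2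

theorem reachable_within_of_walk (w : G.Walk x y) (h : ∀ z ∈ w.support, z ∈ A) :
    (within G A).Reachable x y := by
  induction w with
  | nil => rfl
  | @cons u v _ huv p ih =>
    have hu : u ∈ A := h u (by simp)
    have hv : v ∈ A := h v (by simp)
    exact (SimpleGraph.Adj.reachable (G := within G A) ⟨huv, hu, hv⟩).trans
      (ih fun z hz => h z (by simp [hz]))

theorem exists_walk_of_reachable_within (h : (within G A).Reachable x y) (hx : x ∈ A) :
    ∃ w : G.Walk x y, ∀ z ∈ w.support, z ∈ A := by
  obtain ⟨w⟩ := h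
  induction w with
  | nil => exact ⟨SimpleGraph.Walk.nil, by simpa using hx⟩
  | cons h _ ih =>
    obtain ⟨w, hw⟩ := ih h.2.2
    refine ⟨SimpleGraph.Walk.cons h.1 w, fun z hz => ?_⟩
    rw [SimpleGraph.Walk.support_cons, List.mem_cons] at hz
    rcases hz with rfl | hz
    · exact hx
    · exact hw z hz

/-- Any walk inside `A` shortens to a path, and paths in an acyclic graph are unique. -/
theorem reachable_within_iff (hG : G.IsAcyclic) {p : G.Walk x y} (hp : p.IsPath) (hx : x ∈ A) :
    (within G A).Reachable x y ↔ ∀ z ∈ p.support, z ∈ A := by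
  classical
  refine ⟨fun h => ?_, reachable_within_of_walk p⟩
  obtain ⟨w, hw⟩ := exists_walk_of_reachable_within h hx
  intro z hz
  have hp' : p = w.toPath :=
    congrArg Subtype.val ((hG.subsingleton_path x y).elim ⟨p, hp⟩ w.toPath)
  exact hw z (w.support_toPath_subset_support (hp' ▸ hz))

theorem exists_isPath (hG : G.Connected) (x y : V) : ∃ p : G.Walk x y, p.IsPath := by
  obtain ⟨p, hp, -⟩ := hG.exists_walk_length_eq_dist x y |>.imp fun p hp =>
    (⟨p.isPath_of_length_eq_dist hp, trivial⟩ : p.IsPath ∧ True)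
  exact ⟨p, hp⟩

/-- The one path from `x` to `y` avoids each vertex of `A`, hence all of `A`. -/
theorem reachable_within_compl_of_forall (hG : G.IsTree)
    (hx : x ∉ A) (h : ∀ v ∈ A, (within G {v}ᶜ).Reachable x y) : (within G Aᶜ).Reachable x y := by
  obtain ⟨p, hp⟩ := exists_isPath hG.1 x y
  refine (reachable_within_iff hG.2 hp hx).2 fun z hz hzA => ?_
  have hxz : x ∈ ({z}ᶜ : Set V) := fun h => hx (h ▸ hzA)
  exact (reachable_within_iff hG.2 hp hxz).1 (h z hzA) z hz rfl

theorem not_reachable_of_adj (hG : G.IsAcyclic) (hx : G.Adj z x) (hy : G.Adj z y) (hxy : x ≠ y) :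
    ¬ (within G {z}ᶜ).Reachable x y := by
  intro h
  have hp : (SimpleGraph.Walk.cons hx.symm (SimpleGraph.Walk.cons hy .nil)).IsPath := by
    simp [SimpleGraph.Walk.cons_isPath_iff, hxy, hx.ne.symm, hy.ne]
  exact (reachable_within_iff hG hp hx.ne.symm).1 h z (by simp) rfl

theorem induce_connected_iff : (G.induce A).Connected ↔
    A.Nonempty ∧ ∀ x ∈ A, ∀ y ∈ A, (within G A).Reachable x y := by
  constructor
  · intro h
    obtain ⟨a⟩ := h.nonempty
    refine ⟨⟨a, a.2⟩, fun x hx y hy => ?_⟩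
    let f : G.induce A →g within G A := ⟨Subtype.val, fun {a b} hab => ⟨hab, a.2, b.2⟩⟩
    exact (h.preconnected ⟨x, hx⟩ ⟨y, hy⟩).map f
  · rintro ⟨⟨a, ha⟩, h⟩
    have key : ∀ x y (hx : x ∈ A) (hy : y ∈ A), (within G A).Reachable x y →
        (G.induce A).Reachable ⟨x, hx⟩ ⟨y, hy⟩ := by
      rintro x y hx hy ⟨w⟩
      induction w with
      | nil => rfl
      | cons h _ ih =>
        exact (SimpleGraph.Adj.reachable (G := G.induce A) (u := ⟨_, hx⟩) (v := ⟨_, h.2.2⟩)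
          h.1).trans (ih h.2.2 hy)
    have : Nonempty A := ⟨⟨a, ha⟩⟩
    exact ⟨fun x y => key _ _ x.2 y.2 (h _ x.2 _ y.2)⟩

theorem exists_adj_reachable (hG : G.Connected) (hxz : x ≠ z) :
    ∃ u, G.Adj z u ∧ (within G {z}ᶜ).Reachable u x := by
  obtain ⟨w⟩ := hG.preconnected x z
  induction w with
  | nil => exact (hxz rfl).elim
  | @cons a b c h _ ih =>
    by_cases hb : b = c
    · subst hb
      exact ⟨a, h.symm, .rfl⟩
    · obtain ⟨u, hu, hr⟩ := ih hb
      exact ⟨u, hu, hr.trans (SimpleGraph.Adj.reachable (G := within G {c}ᶜ) ⟨h.symm, hb, hxz⟩)⟩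

end Graphs

/-! ### The label partition cut out by a set of vertices -/

section Trees

variable {n : ℕ} {G G' G'' : StableTree n}

/-- The partition of the labels by a set `S` of vertices: labels at `S` are singletons, and other
labels are equivalent if they are connected outside of `S`. -/
def sep (G : StableTree n) (S : Set G.V) : Setoid (Fin n) where
  -- Reachability in `within` is reflexive even at vertices of `S`; the condition on `G.label i`
  -- keeps distinct labels at one vertex of `S` apart.
  r i j := i = j ∨ G.label i ∉ S ∧ (within G.graph Sᶜ).Reachable (G.label i) (G.label j)
  iseqv := by
    refine ⟨fun _ => Or.inl rfl, ?_, ?_⟩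
    · rintro i j (rfl | ⟨hi, h⟩)
      · exact Or.inl rfl
      · exact Or.inr ⟨mem_of_reachable_within h hi, h.symm⟩
    · rintro i j k (rfl | ⟨hi, h⟩) (rfl | ⟨hj, h'⟩)
      · exact Or.inl rfl
      · exact Or.inr ⟨hj, h'⟩
      · exact Or.inr ⟨hi, h⟩
      · exact Or.inr ⟨hi, h.trans h'⟩

theorem sep_iff {S : Set G.V} {i j : Fin n} : sep G S i j ↔
    i = j ∨ G.label i ∉ S ∧ (within G.graph Sᶜ).Reachable (G.label i) (G.label j) := Iff.rfl

theorem sep_anti {S T : Set G.V} (h : S ⊆ T) : sep G T ≤ sep G S := by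
  rintro i j (rfl | ⟨hi, hr⟩)
  · exact Or.inl rfl
  · exact Or.inr ⟨fun hS => hi (h hS), hr.mono (within_mono (Set.compl_subset_compl.2 h))⟩

theorem sep_of_forall {S : Set G.V} {i j : Fin n} (h : ∀ v ∈ S, sep G {v} i j) : sep G S i j := by
  by_cases hij : i = j
  · exact Or.inl hij
  · have h' := fun v hv => (h v hv).resolve_left hij
    have hi : G.label i ∉ S := fun hi => (h' _ hi).1 rfl
    exact Or.inr ⟨hi, reachable_within_compl_of_forall G.isTree hi fun v hv => (h' v hv).2⟩

theorem sep_insert (S : Set G.V) (u : G.V) : sep G (insert u S) = sep G S ⊓ sep G {u} := by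
  refine le_antisymm (le_inf (sep_anti (Set.subset_insert _ _)) (sep_anti (by simp))) ?_
  rintro i j ⟨hS, hu⟩
  refine sep_of_forall ?_
  rintro v (rfl | hv)
  · exact hu
  · exact sep_anti (Set.singleton_subset_iff.2 hv) hS

theorem Contraction.reachable_map (π : Contraction G G') {A : Set G'.V} {x y : G.V}
    (h : (within G.graph (π.toFun ⁻¹' A)).Reachable x y) :
    (within G'.graph A).Reachable (π.toFun x) (π.toFun y) := by
  obtain ⟨w⟩ := h
  induction w with
  | nil => rfl
  | @cons a b _ h _ ih =>
    refine SimpleGraph.Reachable.trans ?_ ih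
    by_cases he : π.toFun a = π.toFun b
    · rw [he]
    · exact SimpleGraph.Adj.reachable (G := within G'.graph A)
        ⟨(π.adj_iff _ _).2 ⟨he, a, b, rfl, rfl, h.1⟩, h.2.1, h.2.2⟩

theorem Contraction.reachable_of_eq (π : Contraction G G') {A : Set G'.V} {x y : G.V}
    (hx : π.toFun x ∈ A) (h : π.toFun x = π.toFun y) :
    (within G.graph (π.toFun ⁻¹' A)).Reachable x y := by
  refine ((induce_connected_iff.1 (π.fiber_connected (π.toFun x))).2 x rfl y h.symm).mono
    (within_mono ?_)
  intro z hz
  rw [Set.mem_preimage, show π.toFun z = π.toFun x from hz]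
  exact hx

theorem Contraction.reachable_comap (π : Contraction G G') {A : Set G'.V} {x y : G.V}
    (hx : π.toFun x ∈ A) (h : (within G'.graph A).Reachable (π.toFun x) (π.toFun y)) :
    (within G.graph (π.toFun ⁻¹' A)).Reachable x y := by
  obtain ⟨w⟩ := h
  generalize hu : π.toFun x = u at w hx
  generalize hv : π.toFun y = v at w
  induction w generalizing x with
  | nil => exact π.reachable_of_eq (hu ▸ hx) (hu.trans hv.symm)
  | cons h _ ih =>
    obtain ⟨-, a, b, ha, hb, hab⟩ := (π.adj_iff _ _).1 h.1
    refine (π.reachable_of_eq (hu ▸ hx) (hu.trans ha.symm)).trans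
      (SimpleGraph.Reachable.trans ?_ (ih hb h.2.2 hv))
    exact SimpleGraph.Adj.reachable (G := within G.graph _)
      ⟨hab, by simpa [ha] using hx, by simpa [hb] using h.2.2⟩

/-- Fibres are connected, so walks in `A` lift to the preimage of `A`, and walks there project. -/
theorem Contraction.sep_preimage (π : Contraction G G') (A : Set G'.V) :
    sep G (π.toFun ⁻¹' A) = sep G' A := by
  ext i j
  rw [sep_iff, sep_iff, ← π.map_label, ← π.map_label, ← Set.preimage_compl]
  refine or_congr_right (and_congr_right fun hi => ⟨π.reachable_map, π.reachable_comap hi⟩)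

theorem Contraction.sep_le (π : Contraction G G') (v : G.V) :
    sep G' {π.toFun v} ≤ sep G {v} := by
  rw [← π.sep_preimage]
  exact sep_anti (by simp)

/-- The composition of contractions. -/
def Contraction.comp (ρ : Contraction G' G'') (π : Contraction G G') : Contraction G G'' where
  toFun v := ρ.toFun (π.toFun v)
  map_label i := by rw [π.map_label, ρ.map_label]
  fiber_connected v'' := by
    have hρ := induce_connected_iff.1 (ρ.fiber_connected v'')
    rw [induce_connected_iff]
    constructor
    · obtain ⟨v', hv'⟩ := hρ.1
      obtain ⟨v, hv⟩ := (induce_connected_iff.1 (π.fiber_connected v')).1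
      exact ⟨v, by simpa [show π.toFun v = v' from hv] using hv'⟩
    · intro x hx y hy
      exact π.reachable_comap (A := {v' | ρ.toFun v' = v''}) hx (hρ.2 _ hx _ hy)
  adj_iff v'' w'' := by
    rw [ρ.adj_iff]
    refine and_congr_right fun hne => ⟨?_, ?_⟩
    · rintro ⟨v', w', rfl, rfl, h⟩
      obtain ⟨-, v, w, rfl, rfl, h'⟩ := (π.adj_iff _ _).1 h
      exact ⟨v, w, rfl, rfl, h'⟩
    · rintro ⟨v, w, rfl, rfl, h⟩
      exact ⟨_, _, rfl, rfl, (π.adj_iff _ _).2 ⟨fun he => hne (by rw [he]), v, w, rfl, rfl, h⟩⟩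

/-- Induction on the size of the branch: if `u` carries at most one label, stability gives a
neighbour `w ≠ v`, whose branch at `u` is contained in that of `u` at `v` and misses `u`. -/
theorem exists_two_labels_of_adj (G : StableTree n) {v u : G.V} (h : G.graph.Adj v u) :
    ∃ i j, i ≠ j ∧ (within G.graph {v}ᶜ).Reachable u (G.label i) ∧
      (within G.graph {v}ᶜ).Reachable u (G.label j) := by
  induction hm : {x | (within G.graph {v}ᶜ).Reachable u x}.ncard using Nat.strong_induction_on
    generalizing v u with
  | _ m ih =>
  by_cases hl : 1 < {i : Fin n | G.label i = u}.ncard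
  · obtain ⟨i, hi, j, hj, hij⟩ := (Set.one_lt_ncard_iff_nontrivial.1 hl)
    refine ⟨i, j, hij, ?_, ?_⟩
    · rw [show G.label i = u from hi]
    · rw [show G.label j = u from hj]
  · have hN : 1 < (G.graph.neighborSet u).ncard := by have := G.stable u; omega
    obtain ⟨w, hw, hwv⟩ := (Set.one_lt_ncard_iff_nontrivial.1 hN).exists_ne v
    have huw : G.graph.Adj u w := hw
    have hsub : ∀ x, (within G.graph {u}ᶜ).Reachable w x →
        (within G.graph {v}ᶜ).Reachable u x := by
      intro x hx
      have hr : (within G.graph {v}ᶜ).Reachable w x := by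
        obtain ⟨p, hp⟩ := exists_isPath G.isTree.1 w x
        refine (reachable_within_iff G.isTree.2 hp hwv).2 fun z hz hzv => ?_
        obtain rfl : z = v := hzv
        have hpz := (reachable_within_iff G.isTree.2 hp huw.ne.symm).1 hx
        classical
        -- A path through `v` would join the distinct neighbours `w` and `v` of `u` while avoiding
        -- `u`.
        refine not_reachable_of_adj G.isTree.2 huw h.symm hwv
          (reachable_within_of_walk (p.takeUntil z hz) fun y hy => hpz y ?_)
        exact p.support_takeUntil_subset_support hz hy
      exact (SimpleGraph.Adj.reachable (G := within G.graph {v}ᶜ)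
        ⟨huw, h.ne.symm, hwv⟩).trans hr
    obtain ⟨i, j, hij, hi, hj⟩ := ih _ (by
      rw [← hm]
      refine Set.ncard_lt_ncard ⟨hsub, fun hs => ?_⟩ (Set.toFinite _)
      exact mem_of_reachable_within (hs (SimpleGraph.Reachable.refl u)) huw.ne.symm rfl) huw rfl
    exact ⟨i, j, hij, hsub _ hi, hsub _ hj⟩

theorem exists_two_labels (G : StableTree n) {v x : G.V} (h : x ≠ v) :
    ∃ i j, i ≠ j ∧ (within G.graph {v}ᶜ).Reachable x (G.label i) ∧
      (within G.graph {v}ᶜ).Reachable x (G.label j) := by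
  obtain ⟨u, hu, hr⟩ := exists_adj_reachable G.isTree.1 h
  obtain ⟨i, j, hij, hi, hj⟩ := exists_two_labels_of_adj G hu
  exact ⟨i, j, hij, hr.symm.trans hi, hr.symm.trans hj⟩

/-- Each edge at `v`, leaves included, leads to a label, and different edges lead to inequivalent
ones. -/
theorem hasThree_sep (G : StableTree n) (v : G.V) : HasThree (sep G {v}) := by
  classical
  choose f _ _ hf _ using fun u : G.graph.neighborSet v => exists_two_labels_of_adj G u.2
  let g : G.graph.neighborSet v ⊕ {i : Fin n | G.label i = v} → Fin n :=
    Sum.elim f Subtype.val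
  have hg : ∀ a b, a ≠ b → ¬ sep G {v} (g a) (g b) := by
    have h₁ : ∀ (u : G.graph.neighborSet v) (i : {i : Fin n | G.label i = v}),
        ¬ sep G {v} i (f u) := by
      rintro u i (he | ⟨hi, -⟩)
      · refine mem_of_reachable_within (hf u) u.2.ne.symm ?_
        rw [← he]
        exact i.2
      · exact hi i.2
    rintro (a | a) (b | b) hab h
    · rcases h with h | ⟨-, h⟩
      · refine not_reachable_of_adj G.isTree.2 a.2 b.2 (fun h => hab (by rw [Subtype.ext h]))
          ((hf a).trans ?_)
        rw [show f a = f b from h]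
        exact (hf b).symm
      · exact not_reachable_of_adj G.isTree.2 a.2 b.2 (fun h => hab (by rw [Subtype.ext h]))
          ((hf a).trans (h.trans (hf b).symm))
    · exact h₁ a b ((sep G {v}).symm h)
    · exact h₁ b a h
    · rcases h with h | ⟨h, -⟩
      · exact hab (by rw [Subtype.ext h])
      · exact h a.2
  have hc : 3 ≤ Nat.card (G.graph.neighborSet v ⊕ {i : Fin n | G.label i = v}) := by
    rw [Nat.card_sum]
    exact G.stable v
  let _ := Fintype.ofFinite (G.graph.neighborSet v ⊕ {i : Fin n | G.label i = v})
  rw [Nat.card_eq_fintype_card] at hc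
  obtain ⟨a, b, c, hab, hac, hbc⟩ := Fintype.two_lt_card_iff.1 hc
  exact ⟨g a, g b, g c, hg _ _ hab, hg _ _ hac, hg _ _ hbc⟩

theorem nonDiscrete_sep_iff {v : G.V} : NonDiscrete (sep G {v}) ↔ Nontrivial G.V := by
  constructor
  · rintro ⟨i, j, hij, h⟩
    exact ⟨_, _, (h.resolve_left hij).1⟩
  · intro h
    obtain ⟨x, hx⟩ := exists_ne v
    obtain ⟨i, j, hij, hi, hj⟩ := exists_two_labels G hx
    exact ⟨i, j, hij, Or.inr ⟨mem_of_reachable_within hi hx, hi.symm.trans hj⟩⟩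

/-- The set partition of a vertex. -/
noncomputable def setPart (G : StableTree n) (v : G.V) : SetPartition n := classes (sep G {v})

theorem rel_setPart (G : StableTree n) (v : G.V) : rel (setPart G v) = sep G {v} := rel_classes _

theorem three_le_card_setPart (G : StableTree n) (v : G.V) : 3 ≤ (setPart G v).parts.card := by
  rw [three_le_card_iff, rel_setPart]
  exact hasThree_sep G v

theorem card_setPart_le {v : G.V} (h : Nontrivial G.V) : (setPart G v).parts.card ≤ n - 1 := by
  rw [card_le_pred_iff (three_le_card_setPart G v), rel_setPart]
  exact nonDiscrete_sep_iff.2 h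

end Trees

/-! ### Stable trees from laminar families of label sets -/

section Laminar

variable {n : ℕ}

/-- A laminar family of label sets that contains the whole label set, whose members have at least
two elements, and such that three labels are pairwise separated by all proper members. -/
structure IsLaminar (F : Finset (Finset (Fin n))) : Prop where
  univ_mem : Finset.univ ∈ F
  one_lt_card : ∀ A ∈ F, 1 < A.card
  nested : ∀ A ∈ F, ∀ B ∈ F, ∀ i, i ∈ A → i ∈ B → A ⊆ B ∨ B ⊆ A
  -- The whole set has no parent; these labels give its vertex three edges.
  root : ∃ a b c : Fin n, a ≠ b ∧ a ≠ c ∧ b ≠ c ∧ ∀ A ∈ F, A ≠ Finset.univ →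
    ¬ (a ∈ A ∧ b ∈ A) ∧ ¬ (a ∈ A ∧ c ∈ A) ∧ ¬ (b ∈ A ∧ c ∈ A)

variable {F F' : Finset (Finset (Fin n))}

theorem IsLaminar.nonempty (hF : IsLaminar F) (A : F) : A.1.Nonempty :=
  Finset.card_pos.1 (Nat.zero_lt_of_lt (hF.one_lt_card A.1 A.2))

/-- Members sharing the label `i` form a chain, so one of least cardinality is contained in the
others. -/
theorem IsLaminar.exists_least (hF : IsLaminar F) (p : F → Prop) (hp : ∃ A, p A) (i : Fin n)
    (hi : ∀ A, p A → i ∈ A.1) : ∃ A, p A ∧ ∀ B, p B → A.1 ⊆ B.1 := by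
  obtain ⟨A, hA, hmin⟩ := WellFounded.has_min (measure fun A : F => A.1.card).wf {A | p A} hp
  refine ⟨A, hA, fun B hB => ?_⟩
  rcases hF.nested A A.2 B B.2 i (hi A hA) (hi B hB) with h | h
  · exact h
  · exact (Finset.eq_of_subset_of_card_le h (not_lt.1 (hmin B hB))).ge

theorem IsLaminar.exists_hull (hF : IsLaminar F) (s : Finset (Fin n)) (hs : s.Nonempty) :
    ∃ A : F, s ⊆ A.1 ∧ ∀ B : F, s ⊆ B.1 → A.1 ⊆ B.1 := by
  obtain ⟨i, hi⟩ := hs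
  exact hF.exists_least (fun A => s ⊆ A.1) ⟨⟨_, hF.univ_mem⟩, Finset.subset_univ s⟩ i
    fun A h => h hi

theorem IsLaminar.exists_above (hF : IsLaminar F) (A : F) (hA : A.1 ≠ Finset.univ) :
    ∃ B : F, A.1 ⊂ B.1 ∧ ∀ C : F, A.1 ⊂ C.1 → B.1 ⊆ C.1 := by
  obtain ⟨i, hi⟩ := hF.nonempty A
  exact hF.exists_least (fun B => A.1 ⊂ B.1) ⟨⟨_, hF.univ_mem⟩, Finset.ssubset_univ_iff.2 hA⟩ i
    fun B h => h.1 hi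

/-- The smallest member that contains `s`. -/
noncomputable def hull (hF : IsLaminar F) (s : Finset (Fin n)) (hs : s.Nonempty) : F :=
  (hF.exists_hull s hs).choose

theorem subset_hull (hF : IsLaminar F) {s : Finset (Fin n)} (hs : s.Nonempty) :
    s ⊆ (hull hF s hs).1 :=
  (hF.exists_hull s hs).choose_spec.1

theorem hull_subset (hF : IsLaminar F) {s : Finset (Fin n)} (hs : s.Nonempty) {B : F}
    (h : s ⊆ B.1) : (hull hF s hs).1 ⊆ B.1 :=
  (hF.exists_hull s hs).choose_spec.2 B h

theorem hull_eq (hF : IsLaminar F) {s : Finset (Fin n)} (hs : s.Nonempty) {A : F} (h : s ⊆ A.1)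
    (h' : A.1 ⊆ (hull hF s hs).1) : hull hF s hs = A :=
  Subtype.ext (Finset.Subset.antisymm (hull_subset hF hs h) h')

open Classical in
/-- The smallest member that properly contains `A`. -/
noncomputable def up (hF : IsLaminar F) (A : F) : F :=
  -- The root is its own parent, a loop that `SimpleGraph.fromRel` discards.
  if hA : A.1 = Finset.univ then A else (hF.exists_above A hA).choose

theorem up_of_eq_univ (hF : IsLaminar F) {A : F} (hA : A.1 = Finset.univ) : up hF A = A :=
  dif_pos hA

theorem ssubset_up (hF : IsLaminar F) {A : F} (hA : A.1 ≠ Finset.univ) : A.1 ⊂ (up hF A).1 := by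
  rw [up, dif_neg hA]
  exact (hF.exists_above A hA).choose_spec.1

theorem subset_up (hF : IsLaminar F) (A : F) : A.1 ⊆ (up hF A).1 := by
  by_cases hA : A.1 = Finset.univ
  · rw [up_of_eq_univ hF hA]
  · exact (ssubset_up hF hA).1

theorem up_subset (hF : IsLaminar F) {A B : F} (h : A.1 ⊂ B.1) : (up hF A).1 ⊆ B.1 := by
  have hA : A.1 ≠ Finset.univ := fun hA => h.2 (hA ▸ Finset.subset_univ _)
  rw [up, dif_neg hA]
  exact (hF.exists_above A hA).choose_spec.2 B h

theorem up_eq (hF : IsLaminar F) {A B : F} (h : A.1 ⊂ B.1)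
    (h' : ∀ C : F, A.1 ⊂ C.1 → B.1 ⊆ C.1) : up hF A = B :=
  Subtype.ext (Finset.Subset.antisymm (up_subset hF h)
    (h' _ (ssubset_up hF fun hA => h.2 (hA ▸ Finset.subset_univ _))))

theorem ssubset_of_up_eq (hF : IsLaminar F) {A B : F} (hne : A ≠ B) (h : up hF A = B) :
    A.1 ⊂ B.1 := by
  by_cases hA : A.1 = Finset.univ
  · exact (hne ((up_of_eq_univ hF hA).symm.trans h)).elim
  · exact h ▸ ssubset_up hF hA

/-- A property of `B` that passes from `up A` to `A` holds for all members below `B`. -/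
theorem IsLaminar.induction (hF : IsLaminar F) (B : F) (p : F → Prop) (hB : p B)
    (hp : ∀ A : F, A.1 ⊂ B.1 → p (up hF A) → p A) (A : F) (hA : A.1 ⊆ B.1) : p A := by
  induction hm : n - A.1.card using Nat.strong_induction_on generalizing A with
  | _ m ih =>
  rcases hA.eq_or_ssubset with h | h
  · exact (Subtype.ext h : A = B) ▸ hB
  · have hA' : A.1 ≠ Finset.univ := fun hA => h.2 (hA ▸ Finset.subset_univ _)
    refine hp A h (ih _ ?_ _ (up_subset hF h) rfl)
    have h₁ := Finset.card_lt_card (ssubset_up hF hA')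
    have h₂ : (up hF A).1.card ≤ n := by simpa using Finset.card_le_univ (up hF A).1
    omega

/-- The graph in which every member is adjacent to the smallest member properly above it. -/
noncomputable def laminarGraph (hF : IsLaminar F) : SimpleGraph F :=
  SimpleGraph.fromRel fun A B => up hF A = B

theorem adj_up (hF : IsLaminar F) {A : F} (hA : A.1 ≠ Finset.univ) :
    (laminarGraph hF).Adj A (up hF A) :=
  ⟨fun h => (ssubset_up hF hA).ne (congrArg Subtype.val h), Or.inl rfl⟩

/-- Climbing to the root shows connectedness; every edge joins a nonroot member to its parent, so
there are fewer edges than vertices. -/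
theorem laminarGraph_isTree (hF : IsLaminar F) : (laminarGraph hF).IsTree := by
  have hconn : (laminarGraph hF).Connected := by
    have : Nonempty F := ⟨⟨_, hF.univ_mem⟩⟩
    have key : ∀ A, (laminarGraph hF).Reachable A ⟨_, hF.univ_mem⟩ := fun A =>
      hF.induction ⟨_, hF.univ_mem⟩ _ .rfl
        (fun A hA h => (adj_up hF hA.ne).reachable.trans h) A (Finset.subset_univ _)
    exact ⟨fun A B => (key A).trans (key B).symm⟩
  rw [SimpleGraph.isTree_iff_connected_and_card]
  refine ⟨hconn, le_antisymm ?_ hconn.card_vert_le_card_edgeSet_add_one⟩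
  let f : {A : F // A ≠ ⟨_, hF.univ_mem⟩} → (laminarGraph hF).edgeSet := fun A =>
    ⟨s(A.1, up hF A.1), adj_up hF fun h => A.2 (Subtype.ext h)⟩
  have hf : Function.Surjective f := by
    rintro ⟨e, he⟩
    induction e with
    | _ A B =>
    obtain ⟨hne, h | h⟩ := he
    · have := ssubset_of_up_eq hF hne h
      exact ⟨⟨A, fun hA => this.2 (hA ▸ Finset.subset_univ _)⟩, Subtype.ext (by simp [f, h])⟩
    · have := ssubset_of_up_eq hF hne.symm h
      exact ⟨⟨B, fun hA => this.2 (hA ▸ Finset.subset_univ _)⟩,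
        Subtype.ext (by simp [f, h, Sym2.eq_swap])⟩
  have h₁ := Nat.card_le_card_of_surjective f hf
  have h₂ : Nat.card {A : F // A ≠ ⟨_, hF.univ_mem⟩} < Nat.card F :=
    Finite.card_subtype_lt (x := ⟨_, hF.univ_mem⟩) fun h => h rfl
  omega

/-- The smallest member that contains the label `i`. -/
noncomputable def laminarLabel (hF : IsLaminar F) (i : Fin n) : F :=
  hull hF {i} (Finset.singleton_nonempty i)

theorem mem_laminarLabel (hF : IsLaminar F) (i : Fin n) : i ∈ (laminarLabel hF i).1 :=
  subset_hull hF _ (Finset.mem_singleton_self i)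

theorem laminarLabel_subset (hF : IsLaminar F) {i : Fin n} {A : F} (h : i ∈ A.1) :
    (laminarLabel hF i).1 ⊆ A.1 :=
  hull_subset hF _ (Finset.singleton_subset_iff.2 h)

theorem laminarLabel_eq (hF : IsLaminar F) {i : Fin n} {A : F} (h : i ∈ A.1)
    (h' : ∀ B : F, i ∈ B.1 → A.1 ⊆ B.1) : laminarLabel hF i = A :=
  hull_eq hF _ (Finset.singleton_subset_iff.2 h) (h' _ (mem_laminarLabel hF i))

theorem exists_child (hF : IsLaminar F) {A : F} {i : Fin n} (hi : i ∈ A.1)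
    (h : laminarLabel hF i ≠ A) : ∃ X : F, up hF X = A ∧ X.1 ⊂ A.1 ∧ i ∈ X.1 := by
  obtain ⟨X, ⟨hX, hiX⟩, hmax⟩ := WellFounded.has_min (measure fun X : F => n - X.1.card).wf
    {X : F | X.1 ⊂ A.1 ∧ i ∈ X.1} ⟨laminarLabel hF i,
      (laminarLabel_subset hF hi).ssubset_of_ne fun h' => h (Subtype.ext h'),
      mem_laminarLabel hF i⟩
  refine ⟨X, ?_, hX, hiX⟩
  by_contra hne
  have hX' : X.1 ≠ Finset.univ := fun hA => hX.2 (hA ▸ Finset.subset_univ _)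
  refine hmax (up hF X) ⟨(up_subset hF hX).ssubset_of_ne fun h' => hne (Subtype.ext h'),
    subset_up hF X hiX⟩ ?_
  have h₁ := Finset.card_lt_card (ssubset_up hF hX')
  have h₂ : (up hF X).1.card ≤ n := by simpa using Finset.card_le_univ (up hF X).1
  change n - (up hF X).1.card < n - X.1.card
  omega

/-- Two labels reached through different downward edges at `A`. If `i` lies in a child `X`, take `j`
in `A` outside `X`: a member containing both properly contains `X`, hence contains `A`. -/
theorem exists_separated (hF : IsLaminar F) (A : F) : ∃ i ∈ A.1, ∃ j ∈ A.1, i ≠ j ∧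
    ∀ X : F, X.1 ⊂ A.1 → i ∈ X.1 → j ∉ X.1 := by
  obtain ⟨i, hi, k, hk, hik⟩ := Finset.one_lt_card.1 (hF.one_lt_card A.1 A.2)
  by_cases h : laminarLabel hF i = A
  · refine ⟨i, hi, k, hk, hik, fun X hX hiX => (hX.2 ?_).elim⟩
    exact h ▸ laminarLabel_subset hF hiX
  · obtain ⟨X, hXA, hX, hiX⟩ := exists_child hF hi h
    obtain ⟨j, hj, hjX⟩ := Finset.exists_of_ssubset hX
    refine ⟨i, hi, j, hj, fun h => hjX (h ▸ hiX), fun Y hY hiY hjY => ?_⟩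
    rcases hF.nested X X.2 Y Y.2 i hiX hiY with h' | h'
    · refine hY.2 (hXA ▸ up_subset hF (h'.ssubset_of_ne fun h' => hjX (h' ▸ hjY)))
    · exact hjX (h' hjY)

theorem laminar_stable (hF : IsLaminar F) (A : F) :
    3 ≤ ((laminarGraph hF).neighborSet A).ncard + {i : Fin n | laminarLabel hF i = A}.ncard := by
  -- `T x i`: the downward edge or leaf `x` at `A` leads to the label `i`.
  let T : (laminarGraph hF).neighborSet A ⊕ {i : Fin n | laminarLabel hF i = A} → Fin n → Prop :=
    fun x i => Sum.elim (fun X => X.1.1 ⊂ A.1 ∧ i ∈ X.1.1) (fun j => j.1 = i) x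
  have hT : ∀ i ∈ A.1, ∃ x, T x i := by
    intro i hi
    by_cases h : laminarLabel hF i = A
    · exact ⟨Sum.inr ⟨i, h⟩, rfl⟩
    · obtain ⟨X, hXA, hX, hiX⟩ := exists_child hF hi h
      exact ⟨Sum.inl ⟨X, fun h => hX.ne (congrArg Subtype.val h.symm), Or.inr hXA⟩, hX, hiX⟩
  have hne : ∀ i j x y, i ≠ j → (∀ X : F, X.1 ⊂ A.1 → i ∈ X.1 → j ∉ X.1) → T x i → T y j →
      x ≠ y := by
    rintro i j (x | x) y hij h hx hy rfl
    · exact h x.1 hx.1 hx.2 hy.2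
    · exact hij (Eq.trans (Eq.symm hx) hy)
  suffices h : ∃ x y z : (laminarGraph hF).neighborSet A ⊕ {i : Fin n | laminarLabel hF i = A},
      x ≠ y ∧ x ≠ z ∧ y ≠ z by
    have _ := Fintype.ofFinite
      ((laminarGraph hF).neighborSet A ⊕ {i : Fin n | laminarLabel hF i = A})
    have h := Fintype.two_lt_card_iff.2 h
    rw [← Nat.card_eq_fintype_card, Nat.card_sum] at h
    exact h
  by_cases hA : A.1 = Finset.univ
  · obtain ⟨a, b, c, hab, hac, hbc, h⟩ := hF.root
    have hmem : ∀ i, i ∈ A.1 := fun i => hA ▸ Finset.mem_univ i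
    obtain ⟨x, hx⟩ := hT a (hmem a)
    obtain ⟨y, hy⟩ := hT b (hmem b)
    obtain ⟨z, hz⟩ := hT c (hmem c)
    have h' : ∀ X : F, X.1 ⊂ A.1 → _ := fun X hX => h X.1 X.2 (hA ▸ hX.ne)
    exact ⟨x, y, z, hne _ _ _ _ hab (fun X hX h₁ h₂ => (h' X hX).1 ⟨h₁, h₂⟩) hx hy,
      hne _ _ _ _ hac (fun X hX h₁ h₂ => (h' X hX).2.1 ⟨h₁, h₂⟩) hx hz,
      hne _ _ _ _ hbc (fun X hX h₁ h₂ => (h' X hX).2.2 ⟨h₁, h₂⟩) hy hz⟩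
  · obtain ⟨i, hi, j, hj, hij, h⟩ := exists_separated hF A
    obtain ⟨x, hx⟩ := hT i hi
    obtain ⟨y, hy⟩ := hT j hj
    have hup : ∀ k x, T x k → Sum.inl ⟨up hF A, adj_up hF hA⟩ ≠ x := by
      rintro k _ hx rfl
      exact hx.1.2 (subset_up hF A)
    exact ⟨_, x, y, hup i x hx, hup j y hy, hne _ _ _ _ hij h hx hy⟩

/-- The stable tree whose internal vertices are the members of a laminar family. -/
noncomputable def laminarTree (hF : IsLaminar F) : StableTree n where
  V := F
  graph := laminarGraph hF
  isTree := laminarGraph_isTree hF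
  label := laminarLabel hF
  stable := laminar_stable hF

/-- The vertex of the whole label set. -/
def top (hF : IsLaminar F) : (laminarTree hF).V := (⟨_, hF.univ_mem⟩ : F)

/-! ### Laminar subfamilies are contractions -/

section Contraction

variable (hF : IsLaminar F) (hF' : IsLaminar F')

/-- The smallest member of the subfamily `F'` above a member of `F`. -/
noncomputable def hullMap (A : F) : F' := hull hF' A.1 (hF.nonempty A)

/-- The edges from a member outside `F'` to its parent are the collapsed ones. -/
theorem hullMap_up (h : F' ⊆ F) {A : F} (hA : (hullMap hF hF' A).1 ≠ A.1) :
    hullMap hF hF' (up hF A) = hullMap hF hF' A := by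
  have hsub : A.1 ⊆ (hullMap hF hF' A).1 := subset_hull hF' _
  refine hull_eq hF' _ ?_ (hull_subset hF' _ ((subset_up hF A).trans (subset_hull hF' _)))
  exact up_subset hF (B := ⟨_, h (hullMap hF hF' A).2⟩) (hsub.ssubset_of_ne hA.symm)

theorem hullMap_of_mem {A : F} (hA : A.1 ∈ F') : hullMap hF hF' A = ⟨A.1, hA⟩ :=
  hull_eq hF' _ subset_rfl (subset_hull hF' (hF.nonempty A))

/-- The edges from a member of `F'` to its parent are the surviving ones. -/
theorem hullMap_up_of_mem (h : F' ⊆ F) {A : F} (hA : A.1 ∈ F') (hA' : A.1 ≠ Finset.univ) :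
    hullMap hF hF' (up hF A) = up hF' ⟨A.1, hA⟩ := by
  refine hull_eq hF' _ ?_ (up_subset hF' ?_)
  · exact up_subset hF (B := ⟨_, h (up hF' ⟨A.1, hA⟩).2⟩) (ssubset_up hF' (A := ⟨A.1, hA⟩) hA')
  · exact (ssubset_up hF hA').trans_subset (subset_hull hF' (hF.nonempty (up hF A)))

/-- Passing to a laminar subfamily is a contraction. -/
noncomputable def laminarContraction (h : F' ⊆ F) :
    Contraction (laminarTree hF) (laminarTree hF') where
  toFun := hullMap hF hF'
  map_label i := by
    have hi : i ∈ (hullMap hF hF' (laminarLabel hF i)).1 :=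
      subset_hull hF' _ (mem_laminarLabel hF i)
    refine (laminarLabel_eq hF' hi fun B hB => ?_).symm
    exact hull_subset hF' _ (laminarLabel_subset hF (A := ⟨B.1, h B.2⟩) hB)
  fiber_connected B := by
    rw [induce_connected_iff]
    have hB : hullMap hF hF' ⟨B.1, h B.2⟩ = B := hullMap_of_mem hF hF' B.2
    have key : ∀ A : F, A.1 ⊆ B.1 → hullMap hF hF' A = B →
        (within (laminarGraph hF) {A | hullMap hF hF' A = B}).Reachable A ⟨B.1, h B.2⟩ := by
      refine hF.induction ⟨B.1, h B.2⟩ _ (fun _ => .rfl) fun A hA ih hAB => ?_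
      have hup : hullMap hF hF' (up hF A) = B :=
        (hullMap_up hF hF' h fun he => hA.ne (he ▸ congrArg Subtype.val hAB)).trans hAB
      refine SimpleGraph.Reachable.trans (SimpleGraph.Adj.reachable ?_) (ih hup)
      exact ⟨adj_up hF fun hu => hA.2 (hu ▸ Finset.subset_univ _), hAB, hup⟩
    have key' : ∀ A : F, hullMap hF hF' A = B →
        (within (laminarGraph hF) {A | hullMap hF hF' A = B}).Reachable A ⟨B.1, h B.2⟩ :=
      fun A hA => key A (hA ▸ subset_hull hF' (hF.nonempty A)) hA
    exact ⟨⟨_, hB⟩, fun A hA C hC => (key' A hA).trans (key' C hC).symm⟩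
  adj_iff A B := by
    have key : ∀ A B : F', A ≠ B → up hF' A = B →
        ∃ X Y : F, hullMap hF hF' X = A ∧ hullMap hF hF' Y = B ∧ (laminarGraph hF).Adj X Y := by
      intro A B hne hAB
      have hA : A.1 ≠ Finset.univ := fun hA => hne ((up_of_eq_univ hF' hA).symm.trans hAB)
      exact ⟨⟨A.1, h A.2⟩, up hF ⟨A.1, h A.2⟩, hullMap_of_mem hF hF' A.2,
        (hullMap_up_of_mem hF hF' h A.2 hA).trans hAB, adj_up hF hA⟩
    have key' : ∀ X Y : F, X ≠ Y → up hF X = Y → hullMap hF hF' X ≠ hullMap hF hF' Y →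
        up hF' (hullMap hF hF' X) = hullMap hF hF' Y := by
      rintro X _ hne rfl hne'
      have hX : (hullMap hF hF' X).1 = X.1 := by
        by_contra hX
        exact hne' (hullMap_up hF hF' h hX).symm
      have hX' : X.1 ∈ F' := hX ▸ (hullMap hF hF' X).2
      rw [hullMap_up_of_mem hF hF' h hX' fun hu => hne (up_of_eq_univ hF hu).symm,
        hullMap_of_mem hF hF' hX']
    constructor
    · rintro ⟨hne, hAB | hAB⟩
      · exact ⟨hne, key A B hne hAB⟩
      · obtain ⟨X, Y, hX, hY, hXY⟩ := key B A hne.symm hAB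
        exact ⟨hne, Y, X, hY, hX, hXY.symm⟩
    · rintro ⟨hne, X, Y, rfl, rfl, hXY, hup | hup⟩
      · exact ⟨hne, Or.inl (key' X Y hXY hup hne)⟩
      · exact ⟨hne, Or.inr (key' Y X hXY.symm hup hne.symm)⟩

theorem laminarContraction_of_mem (h : F' ⊆ F) {A : F} (hA : A.1 ∈ F') :
    (laminarContraction hF hF' h).toFun A = (⟨A.1, hA⟩ : F') :=
  hullMap_of_mem hF hF' hA

theorem laminarContraction_top (h : F' ⊆ F) :
    (laminarContraction hF hF' h).toFun (top hF) = top hF' :=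
  hullMap_of_mem hF hF' hF'.univ_mem

end Contraction

/-- Labels are equivalent at the vertex `B` if both lie outside of `B` or some member properly
below `B` contains both. -/
theorem sep_laminarTree (hF : IsLaminar F) (B : F) {i j : Fin n} :
    sep (laminarTree hF) {B} i j ↔
      i = j ∨ (i ∉ B.1 ∧ j ∉ B.1) ∨ ∃ A : F, A.1 ⊂ B.1 ∧ i ∈ A.1 ∧ j ∈ A.1 := by
  let R := (within (laminarGraph hF) {B}ᶜ).Reachable
  have hstep : ∀ X : F, X.1 ≠ Finset.univ → X ≠ B → up hF X ≠ B → R X (up hF X) :=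
    fun X hX h₁ h₂ => SimpleGraph.Adj.reachable ⟨adj_up hF hX, h₁, h₂⟩
  have hlabel : ∀ k : Fin n, k ∉ B.1 → laminarLabel hF k ≠ B := fun k hk h =>
    hk (h ▸ mem_laminarLabel hF k)
  constructor
  · rintro (hij | ⟨hi, hr⟩)
    · exact Or.inl hij
    right
    have hr : R (laminarLabel hF i) (laminarLabel hF j) := hr
    have hi : laminarLabel hF i ≠ B := hi
    -- An invariant of walks that avoid `B`: they stay outside the part below `B`, or below one
    -- member properly contained in `B`.
    let C : F → F → Prop := fun X Y =>
      (¬ X.1 ⊆ B.1 ∧ ¬ Y.1 ⊆ B.1) ∨ ∃ A : F, A.1 ⊂ B.1 ∧ X.1 ⊆ A.1 ∧ Y.1 ⊆ A.1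
    have hC : ∀ X Y, X ≠ B → R X Y → C X Y := by
      rintro X Y hX ⟨w⟩
      induction w with
      | @nil X =>
        by_cases hXB : X.1 ⊆ B.1
        · exact Or.inr ⟨X, hXB.ssubset_of_ne fun h => hX (Subtype.ext h), subset_rfl, subset_rfl⟩
        · exact Or.inl ⟨hXB, hXB⟩
      | @cons X Y Z hXY _ ih =>
        obtain ⟨⟨hne, hup⟩, -, hYB⟩ := hXY
        rcases hup with hup | hup <;> rcases ih hYB with ⟨h₁, h₂⟩ | ⟨A, hA, h₁, h₂⟩
        · refine Or.inl ⟨fun h => h₁ ?_, h₂⟩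
          exact hup ▸ up_subset hF (h.ssubset_of_ne fun h => hX (Subtype.ext h))
        · exact Or.inr ⟨A, hA, (subset_up hF X).trans (hup ▸ h₁), h₂⟩
        · exact Or.inl ⟨fun h => h₁ ((subset_up hF Y).trans (hup ▸ h)), h₂⟩
        -- Here `X` is the parent of `Y`. If `Y = A`, the walk climbs above `A`, and `X`, still
        -- properly below `B`, replaces `A`.
        · rcases h₁.eq_or_ssubset with h | h
          · have hYA : Y = A := Subtype.ext h
            subst hYA
            refine Or.inr ⟨X, ?_, subset_rfl, h₂.trans (hup ▸ subset_up hF Y)⟩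
            exact (hup ▸ up_subset hF hA : X.1 ⊆ B.1).ssubset_of_ne fun h => hX (Subtype.ext h)
          · exact Or.inr ⟨A, hA, hup ▸ up_subset hF h, h₂⟩
    rcases hC _ _ hi hr with ⟨h₁, h₂⟩ | ⟨A, hA, h₁, h₂⟩
    · exact Or.inl ⟨fun h => h₁ (laminarLabel_subset hF h), fun h => h₂ (laminarLabel_subset hF h)⟩
    · exact Or.inr ⟨A, hA, h₁ (mem_laminarLabel hF i), h₂ (mem_laminarLabel hF j)⟩
  · rintro (hij | ⟨hi, hj⟩ | ⟨A, hA, hi, hj⟩)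
    · exact Or.inl hij
    · have hB : B.1 ≠ Finset.univ := fun h => hi (h ▸ Finset.mem_univ i)
      have key : ∀ k : Fin n, k ∉ B.1 → R (laminarLabel hF k) ⟨_, hF.univ_mem⟩ := fun k hk =>
        hF.induction ⟨_, hF.univ_mem⟩ (fun X => k ∈ X.1 → R X ⟨_, hF.univ_mem⟩) (fun _ => .rfl)
          (fun X hX ih hk' => (hstep X hX.ne (fun h => hk (h ▸ hk')) fun h =>
            hk (h ▸ subset_up hF X hk')).trans (ih (subset_up hF X hk')))
          _ (Finset.subset_univ _) (mem_laminarLabel hF k)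
      exact Or.inr ⟨hlabel i hi, (key i hi).trans (key j hj).symm⟩
    · have key : ∀ k ∈ A.1, R (laminarLabel hF k) A := fun k hk =>
        hF.induction A (fun X => R X A) .rfl
          (fun X hX ih => (hstep X (fun h => hX.2 (h ▸ Finset.subset_univ _))
            (fun h => hA.2 (h ▸ hX.1)) fun h => hA.2 (h ▸ up_subset hF hX)).trans ih)
          _ (laminarLabel_subset hF hk)
      exact Or.inr ⟨fun h => hA.2 ((congrArg Subtype.val h.symm).subset.trans
        (laminarLabel_subset hF hi)), (key i hi).trans (key j hj).symm⟩

end Laminar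

/-! ### Stars and two-level trees -/

section Stars

variable {n : ℕ}

/-- The whole label set together with the nonsingleton blocks of two partitions. -/
def pairFamily (Q R : SetPartition n) : Finset (Finset (Fin n)) :=
  insert Finset.univ ((Q.parts ∪ R.parts).filter fun A => 1 < A.card)

theorem mem_pairFamily {Q R : SetPartition n} {A : Finset (Fin n)} : A ∈ pairFamily Q R ↔
    A = Finset.univ ∨ (A ∈ Q.parts ∨ A ∈ R.parts) ∧ 1 < A.card := by
  simp [pairFamily]

theorem pairFamily_subset (Q R : SetPartition n) : pairFamily R R ⊆ pairFamily Q R := by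
  intro A
  rw [mem_pairFamily, mem_pairFamily]
  tauto

theorem rel_of_mem_pairFamily {Q R : SetPartition n} (hQR : rel R ≤ rel Q) {A : Finset (Fin n)}
    (hA : A ∈ pairFamily Q R) (hA' : A ≠ Finset.univ) {i j : Fin n} (hi : i ∈ A) (hj : j ∈ A) :
    rel Q i j := by
  rcases mem_pairFamily.1 hA with h | ⟨h | h, -⟩
  · exact (hA' h).elim
  · exact rel_of_mem h hi hj
  · exact hQR (rel_of_mem h hi hj)

theorem HasThree.ne_univ {P : SetPartition n} (h : HasThree (rel P)) {B : Finset (Fin n)}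
    (hB : B ∈ P.parts) : B ≠ Finset.univ := by
  rintro rfl
  obtain ⟨a, b, -, hab, -⟩ := h
  exact hab (rel_of_mem hB (Finset.mem_univ a) (Finset.mem_univ b))

theorem one_lt_card_part {P : SetPartition n} {i j : Fin n} (hij : i ≠ j) (h : rel P i j) :
    1 < (P.part i).card :=
  Finset.one_lt_card.2 ⟨i, mem_part_self P i, j, rel_iff_mem.1 h, hij⟩

theorem isLaminar_pairFamily {Q R : SetPartition n} (hQ : HasThree (rel Q))
    (hQR : rel R ≤ rel Q) : IsLaminar (pairFamily Q R) where
  univ_mem := mem_pairFamily.2 (Or.inl rfl)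
  one_lt_card A hA := by
    rcases mem_pairFamily.1 hA with rfl | h
    · obtain ⟨a, b, -, hab, -⟩ := hQ
      exact Finset.one_lt_card.2 ⟨a, Finset.mem_univ a, b, Finset.mem_univ b,
        fun h => hab (h ▸ (rel Q).refl a)⟩
    · exact h.2
  nested A hA B hB i hiA hiB := by
    have key : ∀ A ∈ Q.parts, ∀ B ∈ R.parts, i ∈ A → i ∈ B → B ⊆ A := fun A hA B hB hiA hiB j hj =>
      mem_of_rel hA hiA (hQR (rel_of_mem hB hiB hj))
    rcases mem_pairFamily.1 hA with rfl | ⟨hA | hA, -⟩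
    · exact Or.inr (Finset.subset_univ _)
    all_goals rcases mem_pairFamily.1 hB with rfl | ⟨hB | hB, -⟩
    · exact Or.inl (Finset.subset_univ _)
    · exact Or.inl (Q.eq_of_mem_parts hA hB hiA hiB).subset
    · exact Or.inr (key A hA B hB hiA hiB)
    · exact Or.inl (Finset.subset_univ _)
    · exact Or.inl (key B hB A hA hiB hiA)
    · exact Or.inl (R.eq_of_mem_parts hA hB hiA hiB).subset
  root := by
    obtain ⟨a, b, c, hab, hac, hbc⟩ := id hQ
    refine ⟨a, b, c, fun h => hab (h ▸ (rel Q).refl a), fun h => hac (h ▸ (rel Q).refl a),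
      fun h => hbc (h ▸ (rel Q).refl b), fun A hA hA' => ⟨?_, ?_, ?_⟩⟩
    · exact fun h => hab (rel_of_mem_pairFamily hQR hA hA' h.1 h.2)
    · exact fun h => hac (rel_of_mem_pairFamily hQR hA hA' h.1 h.2)
    · exact fun h => hbc (rel_of_mem_pairFamily hQR hA hA' h.1 h.2)

/-- The proper members coming from `R` lie inside blocks of `Q`, so they do not change the partition
at the top. -/
theorem sep_pairFamily_top {Q R : SetPartition n} (hQ : HasThree (rel Q)) (hQR : rel R ≤ rel Q) :
    sep (laminarTree (isLaminar_pairFamily hQ hQR)) {top (isLaminar_pairFamily hQ hQR)} =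
      rel Q := by
  ext i j
  rw [top, sep_laminarTree]
  constructor
  · rintro (rfl | ⟨h, -⟩ | ⟨A, hA, hi, hj⟩)
    · exact (rel Q).refl i
    · exact (h (Finset.mem_univ i)).elim
    · exact rel_of_mem_pairFamily hQR A.2 hA.ne hi hj
  · intro h
    by_cases hij : i = j
    · exact Or.inl hij
    · refine Or.inr (Or.inr ⟨⟨Q.part i, mem_pairFamily.2 (Or.inr ⟨Or.inl (part_mem_parts Q i),
        one_lt_card_part hij h⟩)⟩, ?_, mem_part_self Q i, rel_iff_mem.1 h⟩)
      exact Finset.ssubset_univ_iff.2 (hQ.ne_univ (part_mem_parts Q i))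

/-- The star with a given set partition. -/
noncomputable def star (P : SetPartition n) (hP : HasThree (rel P)) : StableTree n :=
  laminarTree (isLaminar_pairFamily hP le_rfl)

/-- The central vertex of a star. -/
def center (P : SetPartition n) (hP : HasThree (rel P)) : (star P hP).V :=
  top (isLaminar_pairFamily hP le_rfl)

theorem sep_center {P : SetPartition n} (hP : HasThree (rel P)) :
    sep (star P hP) {center P hP} = rel P :=
  sep_pairFamily_top hP le_rfl

theorem up_star {P : SetPartition n} (hF : IsLaminar (pairFamily P P)) {A : pairFamily P P}
    (hA : A.1 ≠ Finset.univ) : up hF A = ⟨_, hF.univ_mem⟩ := by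
  refine up_eq hF (Finset.ssubset_univ_iff.2 hA) fun C hC => ?_
  rcases mem_pairFamily.1 C.2 with h | ⟨h, -⟩
  · exact h.ge
  · exfalso
    have hA' : A.1 ∈ P.parts := by simpa [hA] using (mem_pairFamily.1 A.2).imp_right And.left
    have hC' : C.1 ∈ P.parts := by simpa using h
    obtain ⟨i, hi⟩ := exists_mem_of_mem_parts hA'
    exact hC.ne (P.eq_of_mem_parts hA' hC' hi (hC.1 hi))

/-- If each nonsingleton block of `Q` is one of `P`, then the star of `P` contracts to the star
of `Q`. -/
noncomputable def starContraction {P Q : SetPartition n} (hP : HasThree (rel P))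
    (hQ : HasThree (rel Q)) (h : pairFamily Q Q ⊆ pairFamily P P) :
    Contraction (star P hP) (star Q hQ) :=
  laminarContraction _ _ h

theorem starContraction_center {P Q : SetPartition n} (hP : HasThree (rel P))
    (hQ : HasThree (rel Q)) (h : pairFamily Q Q ⊆ pairFamily P P) :
    (starContraction hP hQ h).toFun (center P hP) = center Q hQ :=
  laminarContraction_top _ _ h

theorem nontrivial_star_iff {P : SetPartition n} (hP : HasThree (rel P)) :
    Nontrivial (star P hP).V ↔ NonDiscrete (rel P) := by
  rw [← sep_center hP, nonDiscrete_sep_iff]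

theorem isBasicPair_star {P : SetPartition n} (hP : HasThree (rel P))
    (hP' : NonDiscrete (rel P)) : IsBasicPair (star P hP) (center P hP) := by
  refine ⟨(nontrivial_star_iff hP).2 hP', fun A hA => ?_⟩
  have hF := isLaminar_pairFamily hP le_rfl
  have hA' : A.1 ≠ Finset.univ := fun h => hA (Subtype.ext h)
  have h := adj_up hF hA'
  rw [up_star hF hA'] at h
  exact h.symm

/-! ### Contracting the branches at a vertex -/

section ToStar

variable (G : StableTree n) (v : G.V)

open Classical in
/-- The labels on the branch of `x` at `v`; all labels if `x = v`. -/
noncomputable def branch (x : G.V) : Finset (Fin n) :=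
  Finset.univ.filter fun i => x = v ∨ (within G.graph {v}ᶜ).Reachable x (G.label i)

variable {G v}

theorem mem_branch {x : G.V} (hx : x ≠ v) {i : Fin n} :
    i ∈ branch G v x ↔ (within G.graph {v}ᶜ).Reachable x (G.label i) := by
  simp [branch, hx]

theorem branch_self : branch G v v = Finset.univ := by simp [branch]

theorem branch_eq_of_mem {x : G.V} (hx : x ≠ v) {i : Fin n} (hi : i ∈ branch G v x) :
    branch G v x = (setPart G v).part i := by
  have hr := (mem_branch hx).1 hi
  ext j
  rw [← rel_iff_mem, rel_setPart, mem_branch hx]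
  constructor
  · exact fun h => Or.inr ⟨mem_of_reachable_within hr hx, hr.symm.trans h⟩
  · rintro (rfl | ⟨-, h⟩)
    · exact hr
    · exact hr.trans h

theorem branch_mem_parts {x : G.V} (hx : x ≠ v) : branch G v x ∈ (setPart G v).parts := by
  obtain ⟨i, -, -, hi, -⟩ := exists_two_labels G hx
  rw [branch_eq_of_mem hx ((mem_branch hx).2 hi)]
  exact part_mem_parts _ i

theorem branch_mem (x : G.V) : branch G v x ∈ pairFamily (setPart G v) (setPart G v) := by
  rw [mem_pairFamily]
  by_cases hx : x = v
  · subst hx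
    exact Or.inl branch_self
  · obtain ⟨i, j, hij, hi, hj⟩ := exists_two_labels G hx
    exact Or.inr ⟨Or.inl (branch_mem_parts hx), Finset.one_lt_card.2
      ⟨i, (mem_branch hx).2 hi, j, (mem_branch hx).2 hj, hij⟩⟩

theorem hasThree_setPart : HasThree (rel (setPart G v)) := by
  rw [rel_setPart]
  exact hasThree_sep G v

theorem branch_eq_univ_iff {x : G.V} : branch G v x = Finset.univ ↔ x = v := by
  refine ⟨fun h => ?_, fun h => h ▸ branch_self⟩
  by_contra hx
  exact hasThree_setPart.ne_univ (branch_mem_parts hx) h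

theorem branch_eq_of_reachable {x y : G.V} (hx : x ≠ v)
    (h : (within G.graph {v}ᶜ).Reachable x y) : branch G v x = branch G v y := by
  ext i
  rw [mem_branch hx, mem_branch (mem_of_reachable_within h hx)]
  exact ⟨h.symm.trans, h.trans⟩

/-- By stability every branch carries a label, so its label set determines it. This makes the fibres
of `toStar` connected. -/
theorem reachable_of_branch_eq {x y : G.V} (hx : x ≠ v) (hy : y ≠ v)
    (h : branch G v x = branch G v y) : (within G.graph {v}ᶜ).Reachable x y := by
  obtain ⟨i, -, -, hi, -⟩ := exists_two_labels G hx
  exact hi.trans ((mem_branch hy).1 (h ▸ (mem_branch hx).2 hi)).symm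

theorem branch_label {i : Fin n} (hi : G.label i ≠ v) :
    branch G v (G.label i) = (setPart G v).part i :=
  branch_eq_of_mem hi ((mem_branch hi).2 .rfl)

variable (G v) in
/-- The contraction of the branches at `v`. -/
noncomputable def toStar : Contraction G (star (setPart G v) hasThree_setPart) where
  toFun x := (⟨branch G v x, branch_mem x⟩ : pairFamily (setPart G v) (setPart G v))
  map_label i := by
    refine (laminarLabel_eq (isLaminar_pairFamily hasThree_setPart le_rfl)
      (A := ⟨branch G v (G.label i), branch_mem (G.label i)⟩) ?_ fun B hB => ?_).symm
    · by_cases hi : G.label i = v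
      · simp [branch, hi]
      · change i ∈ branch G v (G.label i)
        rw [branch_label hi]
        exact mem_part_self _ i
    · change branch G v (G.label i) ⊆ B.1
      rcases mem_pairFamily.1 B.2 with h | ⟨h, hc⟩
      · rw [h]
        exact Finset.subset_univ _
      · have hBp : B.1 ∈ (setPart G v).parts := by simpa using h
        have hi : G.label i ≠ v := by
          obtain ⟨j, hj, hij⟩ := Finset.exists_mem_ne hc i
          have hr := rel_of_mem hBp hB hj
          rw [rel_setPart] at hr
          exact (hr.resolve_left hij.symm).1
        rw [branch_label hi, part_eq hBp hB]
  fiber_connected B := by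
    obtain ⟨B, hB⟩ := B
    have hfib : ∀ x : G.V, x ∈ {x : G.V | (⟨branch G v x, branch_mem x⟩ :
        pairFamily (setPart G v) (setPart G v)) = ⟨B, hB⟩} ↔ branch G v x = B := fun x =>
      Subtype.ext_iff
    rw [induce_connected_iff]
    constructor
    · rcases mem_pairFamily.1 hB with h | ⟨h, hc⟩
      · exact ⟨v, (hfib v).2 (h ▸ branch_self)⟩
      · obtain ⟨i, hi, j, hj, hij⟩ := Finset.one_lt_card.1 hc
        have hBp : B ∈ (setPart G v).parts := by simpa using h
        have hr := rel_of_mem hBp hi hj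
        rw [rel_setPart] at hr
        exact ⟨G.label i, (hfib _).2
          ((branch_label (hr.resolve_left hij).1).trans (part_eq hBp hi))⟩
    · intro x hx y hy
      replace hx := (hfib x).1 hx
      replace hy := (hfib y).1 hy
      by_cases hxv : x = v
      · have hyv : y = v := branch_eq_univ_iff.1 (by rw [hy, ← hx, hxv, branch_self])
        rw [hxv, hyv]
      · have hyv : y ≠ v := fun h => hxv (branch_eq_univ_iff.1 (by rw [hx, ← hy, h, branch_self]))
        obtain ⟨w⟩ := reachable_of_branch_eq hxv hyv (hx.trans hy.symm)
        induction w with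
        | nil => rfl
        | @cons x z _ h _ ih =>
          have hz : branch G v z = B :=
            (branch_eq_of_reachable hxv (SimpleGraph.Adj.reachable h)).symm.trans hx
          refine SimpleGraph.Reachable.trans (SimpleGraph.Adj.reachable ?_) (ih hz hy h.2.2 hyv)
          exact ⟨h.1, (hfib x).2 hx, (hfib z).2 hz⟩
  adj_iff A B := by
    have hF := isLaminar_pairFamily (hasThree_setPart (G := G) (v := v)) le_rfl
    let f : G.V → pairFamily (setPart G v) (setPart G v) := fun x => ⟨branch G v x, branch_mem x⟩
    have hfv : f v = ⟨_, hF.univ_mem⟩ := Subtype.ext branch_self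
    have key : ∀ A B : pairFamily (setPart G v) (setPart G v), A ≠ B → up hF A = B →
        ∃ x, f x = A ∧ f v = B ∧ G.graph.Adj x v := by
      intro A B hne hAB
      have hA : A.1 ≠ Finset.univ := fun hA => hne ((up_of_eq_univ hF hA).symm.trans hAB)
      have hA' := ((mem_pairFamily.1 A.2).resolve_left hA)
      obtain ⟨i, hi, j, hj, hij⟩ := Finset.one_lt_card.1 hA'.2
      have hAp : A.1 ∈ (setPart G v).parts := by simpa using hA'.1
      have hr := rel_of_mem hAp hi hj
      rw [rel_setPart] at hr
      have hi' := (hr.resolve_left hij).1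
      obtain ⟨u, hu, hur⟩ := exists_adj_reachable G.isTree.1 hi'
      refine ⟨u, Subtype.ext ?_, ?_, hu.symm⟩
      · exact (branch_eq_of_reachable hu.ne.symm hur).trans
          ((branch_label hi').trans (part_eq hAp hi))
      · rw [← hAB, up_star hF hA, hfv]
    have key' : ∀ x y : G.V, f x ≠ f y → G.graph.Adj x y →
        (laminarGraph hF).Adj (f x) (f y) := by
      have hv : ∀ x, f x ≠ f v → up hF (f x) = f v := by
        intro x hx
        rw [hfv] at hx ⊢
        exact up_star hF fun h => hx (Subtype.ext h)
      intro x y hne hxy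
      refine ⟨hne, ?_⟩
      by_cases hy : y = v
      · subst hy
        exact Or.inl (hv x hne)
      · by_cases hx : x = v
        · subst hx
          exact Or.inr (hv y hne.symm)
        · exact (hne (Subtype.ext (branch_eq_of_reachable hx
            (SimpleGraph.Adj.reachable ⟨hxy, hx, hy⟩)))).elim
    constructor
    · rintro ⟨hne, hAB | hAB⟩
      · obtain ⟨x, hx, hv, h⟩ := key A B hne hAB
        exact ⟨hne, x, v, hx, hv, h⟩
      · obtain ⟨x, hx, hv, h⟩ := key B A hne.symm hAB
        exact ⟨hne, v, x, hv, hx, h.symm⟩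
    · rintro ⟨hne, x, y, rfl, rfl, hxy⟩
      exact key' x y hne hxy

theorem toStar_self : (toStar G v).toFun v = center _ hasThree_setPart :=
  Subtype.ext branch_self

theorem toStar_eq_center {x : G.V} (h : (toStar G v).toFun x = center _ hasThree_setPart) :
    x = v :=
  branch_eq_univ_iff.1 (congrArg Subtype.val h)

end ToStar

/-- In a star, distinct neighbours of `v` are separated by `v`, so each branch is a single vertex.
-/
theorem isPartitionOf_setPart {G : StableTree n} {v : G.V} (h : IsBasicPair G v) :
    IsPartitionOf (setPart G v) G v := by
  classical
  have hbr : ∀ w, w ≠ v → branch G v w = Finset.univ.filter (fun i => G.label i = w) := by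
    intro w hw
    ext i
    rw [mem_branch hw, Finset.mem_filter, and_iff_right (Finset.mem_univ i)]
    refine ⟨fun hr => ?_, fun hi => hi ▸ .rfl⟩
    by_contra hne
    exact not_reachable_of_adj G.isTree.2 (h.2 w hw) (h.2 _ (mem_of_reachable_within hr hw))
      (Ne.symm hne) hr
  intro B
  constructor
  · intro hB
    obtain ⟨i, hi⟩ := exists_mem_of_mem_parts hB
    by_cases hiv : G.label i = v
    · refine Or.inl ⟨i, hiv, Finset.eq_singleton_iff_unique_mem.2 ⟨hi, fun j hj => ?_⟩⟩
      have hr := rel_of_mem hB hi hj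
      rw [rel_setPart] at hr
      exact (hr.resolve_right fun h => h.1 hiv).symm
    · refine Or.inr ⟨G.label i, hiv, ?_⟩
      rw [← part_eq hB hi, ← branch_label hiv, hbr _ hiv]
  · rintro (⟨i, hiv, rfl⟩ | ⟨w, hw, rfl⟩)
    · have : (setPart G v).part i = {i} := by
        refine Finset.eq_singleton_iff_unique_mem.2 ⟨mem_part_self _ i, fun j hj => ?_⟩
        have hr := rel_iff_mem.2 hj
        rw [rel_setPart] at hr
        exact (hr.resolve_right fun h => h.1 hiv).symm
      exact this ▸ part_mem_parts _ i
    · convert branch_mem_parts hw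
      rw [hbr w hw]

theorem eq_setPart_of_isPartitionOf {P : SetPartition n} {G : StableTree n} {v : G.V}
    (h : IsBasicPair G v) (hP : IsPartitionOf P G v) : P = setPart G v := by
  ext B
  rw [hP B, isPartitionOf_setPart h B]

theorem setPart_center {P : SetPartition n} (hP : HasThree (rel P)) :
    setPart (star P hP) (center P hP) = P :=
  rel_injective ((rel_setPart _ _).trans (sep_center hP))

theorem isPartitionOf_center {P : SetPartition n} (hP : HasThree (rel P))
    (hP' : NonDiscrete (rel P)) : IsPartitionOf P (star P hP) (center P hP) := by
  have h := isPartitionOf_setPart (isBasicPair_star hP hP')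
  rwa [setPart_center] at h

end Stars

/-! ### Extremal and atomic assignments -/

section Extremal

variable {n : ℕ}

theorem IsExtremal.mem_iff_center {Z : Assignment n} (hZ : IsExtremal Z) {G : StableTree n}
    {v : G.V} {P : SetPartition n} (hP : HasThree (rel P)) (h : sep G {v} = rel P) :
    v ∈ Z G ↔ center P hP ∈ Z (star P hP) := by
  obtain rfl : setPart G v = P := rel_injective ((rel_setPart G v).trans h)
  rw [hZ.mem_iff _ _ (toStar G v)]
  constructor
  · intro h x hx
    rwa [toStar_eq_center hx]
  · exact fun h => h v toStar_self

/-- Replace `v` by the centre of its star. The tree on the nonsingleton blocks of both partitions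
contracts to this star with its top going to the centre, so `Z` contains the top; and the top has
the partition of `v'`. -/
theorem IsExtremal.mem_of_sep_le {Z : Assignment n} (hZ : IsExtremal Z) {G G' : StableTree n}
    {v : G.V} {v' : G'.V} (h : sep G {v} ≤ sep G' {v'}) (hv : v ∈ Z G) : v' ∈ Z G' := by
  have hR := hasThree_setPart (G := G) (v := v)
  have hQ := hasThree_setPart (G := G') (v := v')
  have hQR : rel (setPart G v) ≤ rel (setPart G' v') := by rwa [rel_setPart, rel_setPart]
  rw [hZ.mem_iff_center hR (rel_setPart G v).symm] at hv
  rw [hZ.mem_iff_center hQ (rel_setPart G' v').symm,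
    ← hZ.mem_iff_center hQ (sep_pairFamily_top hQ hQR)]
  exact (hZ.mem_iff _ _ (laminarContraction (isLaminar_pairFamily hQ hQR)
    (isLaminar_pairFamily hR le_rfl) (pairFamily_subset _ _)) _).1 hv _
    (laminarContraction_top _ _ _)

/-- The vertices whose partition is coarser than `P`. -/
def atomic (P : SetPartition n) : Assignment n := fun G => {v | rel P ≤ sep G {v}}

theorem mem_atomic {P : SetPartition n} {G : StableTree n} {v : G.V} :
    v ∈ atomic P G ↔ rel P ≤ sep G {v} := Iff.rfl

theorem not_le_sep_univ {P : SetPartition n} (hP : NonDiscrete (rel P)) (G : StableTree n) :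
    ¬ rel P ≤ sep G Set.univ := by
  obtain ⟨i, j, hij, h⟩ := hP
  exact fun hle => ((hle h).resolve_left hij).1 trivial

/-- Both axioms reduce to `sep_of_forall`: pairs of `P` not separated by single vertices are not
separated by a fibre, nor by the set of all vertices, which separates every pair. -/
theorem isExtremal_atomic {P : SetPartition n} (hP : NonDiscrete (rel P)) :
    IsExtremal (atomic P) where
  ne_univ G h := not_le_sep_univ hP G fun _ _ hij =>
    sep_of_forall fun v _ => (h ▸ Set.mem_univ v : v ∈ atomic P G) hij
  mem_iff G G' π v' := by
    rw [mem_atomic, ← π.sep_preimage]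
    refine ⟨fun h v hv => h.trans (sep_anti (Set.singleton_subset_iff.2 hv)), fun h _ _ hij => ?_⟩
    exact sep_of_forall fun v hv => h v hv hij

theorem isAtomicOf_atomic {P : SetPartition n} (hP : NonDiscrete (rel P)) {G : StableTree n}
    {v : G.V} (h : sep G {v} = rel P) : IsAtomicOf (atomic P) G v :=
  ⟨⟨isExtremal_atomic hP, h.ge⟩, fun _ hZ _ _ hw => hZ.1.mem_of_sep_le (h.trans_le hw) hZ.2⟩

theorem atomic_eq_union {P : SetPartition n} (hP : NonDiscrete (rel P)) : atomic P =
    union (fun Q : {Q : SetPartition n // CurlyLe Q P ∧ 3 ≤ Q.parts.card} => generated Q.1) := by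
  funext H
  ext w
  simp only [union, Set.mem_iUnion]
  constructor
  · intro hw
    -- Breaking up the blocks at `w` on which `P` is trivial gives `Q ⪯ P`. The remaining
    -- nonsingleton blocks are blocks at `w`, so the star at `w` contracts to the star of `Q`.
    let Q := classes (refineBy (sep H {w}) (rel P))
    have hrel : rel Q = refineBy (sep H {w}) (rel P) := rel_classes _
    have hQ3 : HasThree (rel Q) := (hasThree_sep H w).mono (hrel ▸ refineBy_le _ _)
    have hQP : CurlyLe Q P := curlyLe_refineBy hw
    have hQnd : NonDiscrete (rel Q) := hP.mono (hrel ▸ le_refineBy hw)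
    have hsub : pairFamily Q Q ⊆ pairFamily (setPart H w) (setPart H w) := by
      intro A hA
      rcases mem_pairFamily.1 hA with h | ⟨h, hc⟩
      · exact mem_pairFamily.2 (Or.inl h)
      · have hA : A ∈ Q.parts := by simpa using h
        obtain ⟨i, hi, j, hj, hij⟩ := Finset.one_lt_card.1 hc
        have hr := rel_of_mem hA hi hj
        rw [hrel] at hr
        obtain ⟨-, c, d, hic, hcd⟩ := hr.resolve_left hij
        have : (setPart H w).part i = A := by
          ext k
          rw [← rel_iff_mem, rel_setPart]
          constructor
          · intro hk
            refine mem_of_rel hA hi ?_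
            rw [hrel]
            exact Or.inr ⟨hk, c, d, hic, hcd⟩
          · intro hk
            have hr' := rel_of_mem hA hi hk
            rw [hrel] at hr'
            exact refineBy_le _ _ hr'
        exact mem_pairFamily.2 (Or.inr ⟨Or.inl (this ▸ part_mem_parts _ i), hc⟩)
    refine ⟨⟨Q, hQP, three_le_card_iff.2 hQ3⟩, star Q hQ3, center Q hQ3,
      isBasicPair_star hQ3 hQnd, isPartitionOf_center hQ3 hQnd,
      (starContraction hasThree_setPart hQ3 hsub).comp (toStar H w), ?_⟩
    change (starContraction hasThree_setPart hQ3 hsub).toFun ((toStar H w).toFun w) = _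
    rw [toStar_self, starContraction_center]
  · rintro ⟨⟨Q, hQP, _⟩, G, v, hG, hQ, π, hπ⟩
    have h := (curlyLe_iff.1 hQP).1
    rw [eq_setPart_of_isPartitionOf (P := Q) hG hQ, rel_setPart, ← hπ] at h
    exact h.trans (π.sep_le w)

/-- If the edge from `a` to `u` leaves the connected set `T`, then every vertex is on exactly one
side of it. -/
theorem reachable_or_reachable {V : Type*} {G : SimpleGraph V} (hG : G.Connected) {T : Set V}
    (hT : ∀ x ∈ T, ∀ y ∈ T, (within G T).Reachable x y) {a u : V} (ha : a ∈ T) (hu : u ∉ T)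
    (x : V) : (within G Tᶜ).Reachable u x ∨ (within G {u}ᶜ).Reachable a x := by
  obtain ⟨w⟩ := hG.preconnected x u
  induction w with
  | nil => exact Or.inl .rfl
  | @cons x y u h _ ih =>
    rcases ih hu with hr | hr
    · by_cases hx : x ∈ T
      · exact Or.inr ((hT a ha x hx).mono (within_mono fun z hz hzu => hu (hzu ▸ hz)))
      · exact Or.inl (hr.trans (SimpleGraph.Adj.reachable
          (G := within G Tᶜ) ⟨h.symm, mem_of_reachable_within hr hu, hx⟩))
    · by_cases hx : x = u
      · exact Or.inl (hx ▸ .rfl)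
      · have hau : a ∈ ({u}ᶜ : Set V) := fun h => hu (h ▸ ha)
        exact Or.inr (hr.trans (SimpleGraph.Adj.reachable
          (G := within G {u}ᶜ) ⟨h.symm, mem_of_reachable_within hr hau, hx⟩))

/-- A path from `a` to `x` avoiding `u` extends to the path from `u` to `x`, which then passes
through `a`. -/
theorem not_reachable_and_reachable {V : Type*} {G : SimpleGraph V} (hG : G.IsTree) {a u x : V}
    (h : G.Adj a u) (h₁ : (within G {a}ᶜ).Reachable u x) :
    ¬ (within G {u}ᶜ).Reachable a x := by
  intro h₂
  obtain ⟨p, hp⟩ := exists_isPath hG.1 a x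
  have hup : u ∉ p.support := fun hu => (reachable_within_iff hG.2 hp h.ne).1 h₂ u hu rfl
  have hp' : (SimpleGraph.Walk.cons h.symm p).IsPath :=
    SimpleGraph.Walk.cons_isPath_iff _ _ |>.2 ⟨hp, hup⟩
  exact (reachable_within_iff hG.2 hp' h.ne.symm).1 h₁ a (by simp) rfl

/-- For `S` a fibre this is the contraction axiom for the union, for `S` the set of all vertices its
properness. A maximal connected subset that admits some `l` must be `S`, since otherwise an adjacent
vertex can be added. -/
theorem IsTightClosed.exists_le_sep {ι : Type*} {P : ι → SetPartition n} (hP : IsTightClosed P)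
    (G : StableTree n) {S : Set G.V} (hne : S.Nonempty)
    (hS : ∀ x ∈ S, ∀ y ∈ S, (within G.graph S).Reachable x y)
    (h : ∀ v ∈ S, ∃ l, rel (P l) ≤ sep G {v}) : ∃ l, rel (P l) ≤ sep G S := by
  let good : Set (Set G.V) := {T | T ⊆ S ∧ T.Nonempty ∧
    (∀ x ∈ T, ∀ y ∈ T, (within G.graph T).Reachable x y) ∧ ∃ l, rel (P l) ≤ sep G T}
  have hgood : good.Nonempty := by
    obtain ⟨v, hv⟩ := hne
    refine ⟨{v}, Set.singleton_subset_iff.2 hv, ⟨v, rfl⟩, ?_, h v hv⟩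
    rintro x rfl y rfl
    rfl
  obtain ⟨T, ⟨hTS, ⟨x, hx⟩, hT, l, hl⟩, hmax⟩ := Set.Finite.exists_maximal good.toFinite hgood
  rcases hTS.eq_or_ssubset with rfl | hlt
  · exact ⟨l, hl⟩
  exfalso
  obtain ⟨y, hy, hyT⟩ := Set.exists_of_ssubset hlt
  obtain ⟨w⟩ := hS x (hTS hx) y hy
  obtain ⟨⟨⟨a, u⟩, hau⟩, -, ha, hu⟩ := w.exists_boundary_dart T hx hyT
  have huS : u ∈ S := hau.2.2
  have hadj : G.graph.Adj a u := hau.1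
  have ha : a ∈ T := ha
  have hu : u ∉ T := hu
  obtain ⟨m, hm⟩ := h u huS
  have hor := reachable_or_reachable G.isTree.1 hT ha hu
  have hnot : ∀ x, (within G.graph Tᶜ).Reachable u x → ¬ (within G.graph {u}ᶜ).Reachable a x :=
    fun x hr => not_reachable_and_reachable G.isTree hadj
      (hr.mono (within_mono (Set.compl_subset_compl.2 (Set.singleton_subset_iff.2 ha))))
  have hau' : a ∈ ({u}ᶜ : Set G.V) := hadj.ne
  -- The labels beyond the edge from `a` to `u` are one class of `sep G T`, the remaining ones a
  -- class of `sep G {u}`.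
  obtain ⟨k, hk⟩ := hP.exists_le_inf hl hm {i | (within G.graph Tᶜ).Reachable u (G.label i)}
    (by
      intro i hi j
      constructor
      · rintro (rfl | ⟨-, hr⟩)
        · exact hi
        · exact SimpleGraph.Reachable.trans hi hr
      · intro hj
        exact Or.inr ⟨mem_of_reachable_within hi hu, SimpleGraph.Reachable.trans
          (SimpleGraph.Reachable.symm hi) hj⟩)
    (by
      intro i hi j
      have hia := (hor _).resolve_left hi
      constructor
      · rintro (rfl | ⟨-, hr⟩) hj
        · exact hi hj
        · exact hnot _ hj (hia.trans hr)
      · intro hj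
        exact Or.inr ⟨mem_of_reachable_within hia hau', hia.symm.trans ((hor _).resolve_left hj)⟩)
  have hmem : insert u T ∈ good := by
    refine ⟨Set.insert_subset huS hTS, ⟨u, Or.inl rfl⟩, ?_, k, by rwa [sep_insert]⟩
    have key : ∀ x ∈ insert u T, (within G.graph (insert u T)).Reachable a x := by
      rintro x (rfl | hx)
      · exact SimpleGraph.Adj.reachable ⟨hadj, Or.inr ha, Or.inl rfl⟩
      · exact (hT a ha x hx).mono (within_mono (Set.subset_insert _ _))
    exact fun x hx y hy => (key x hx).symm.trans (key y hy)
  exact hu (hmax hmem (Set.subset_insert u T) (Or.inl rfl))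

theorem mem_union_atomic {ι : Type*} {P : ι → SetPartition n} {G : StableTree n} {v : G.V} :
    v ∈ union (fun i => atomic (P i)) G ↔ ∃ l, rel (P l) ≤ sep G {v} :=
  Set.mem_iUnion

theorem IsTightClosed.isExtremal {ι : Type*} {P : ι → SetPartition n} (hP : IsTightClosed P)
    (hnd : ∀ i, NonDiscrete (rel (P i))) : IsExtremal (union fun i => atomic (P i)) where
  ne_univ G h := by
    have hc := G.isTree.1
    obtain ⟨v⟩ := hc.nonempty
    obtain ⟨l, hl⟩ := hP.exists_le_sep G (S := Set.univ) ⟨v, trivial⟩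
      (fun x _ y _ => (hc.preconnected x y).mono fun _ _ h => ⟨h, trivial, trivial⟩)
      (fun v _ => mem_union_atomic.1 (h ▸ Set.mem_univ v))
    exact not_le_sep_univ (hnd l) G hl
  mem_iff G G' π v' := by
    obtain ⟨hne, hconn⟩ := induce_connected_iff.1 (π.fiber_connected v')
    simp only [mem_union_atomic]
    rw [← π.sep_preimage]
    constructor
    · rintro ⟨l, hl⟩ v hv
      exact ⟨l, hl.trans (sep_anti (Set.singleton_subset_iff.2 hv))⟩
    · intro h
      exact hP.exists_le_sep G hne hconn h

/-- The tree on the nonsingleton blocks of `Q₁` and `R` contracts to the star of `R`. Over the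
centre lie the top, with partition `Q₁`, and the blocks of `Q₁` split by `R`, whose partitions are
coarser than `Q₂`. So the union contains the whole fibre, hence the centre. -/
theorem isTightClosed_of_isExtremal {ι : Type*} {P : ι → SetPartition n}
    (h : IsExtremal (union fun i => atomic (P i))) : IsTightClosed P := by
  intro i j Q₁ Q₂ R h₁ h₂ hR
  obtain ⟨hR₁, hR₂, hR⟩ := isTightUpperBound_iff.1 hR
  have h₁ := (curlyLe_iff.1 h₁).1
  have h₂ := (curlyLe_iff.1 h₂).1
  by_cases hle₁ : rel Q₁ ≤ rel R
  · exact ⟨i, le_iff.2 (h₁.trans hle₁)⟩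
  by_cases hle₂ : rel Q₂ ≤ rel R
  · exact ⟨j, le_iff.2 (h₂.trans hle₂)⟩
  -- `R` splits the `Q₁`-block of `a` and the `Q₂`-block of `c` and `d`. By tightness the `R`-blocks
  -- of `c` and `d` are `Q₁`-blocks, distinct from each other and from the split one.
  have h3 : HasThree (rel Q₁) := by
    rw [Setoid.le_def] at hle₁ hle₂
    push Not at hle₁ hle₂
    obtain ⟨a, b, hab, hab'⟩ := hle₁
    obtain ⟨c, d, hcd, hcd'⟩ := hle₂
    have hc := (hR c).resolve_right fun h => hcd' (h d hcd)
    have hd := (hR d).resolve_right fun h => hcd' ((rel R).symm (h c ((rel Q₂).symm hcd)))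
    refine ⟨a, c, d, fun hac => ?_, fun had => ?_, fun h => hcd' (hc d h)⟩
    · exact hab' ((rel R).trans ((rel R).symm (hc a ((rel Q₁).symm hac)))
        (hc b ((rel Q₁).trans ((rel Q₁).symm hac) hab)))
    · exact hab' ((rel R).trans ((rel R).symm (hd a ((rel Q₁).symm had)))
        (hd b ((rel Q₁).trans ((rel Q₁).symm had) hab)))
  have hR3 : HasThree (rel R) := h3.mono hR₁
  have hF := isLaminar_pairFamily h3 hR₁
  have hF' := isLaminar_pairFamily hR3 le_rfl
  have hmem : center R hR3 ∈ union (fun i => atomic (P i)) (star R hR3) := by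
    refine (h.mem_iff _ _ (laminarContraction hF hF' (pairFamily_subset Q₁ R))
      (center R hR3)).2 ?_
    rintro ⟨A, hA⟩ hAtop
    refine mem_union_atomic.2 ?_
    by_cases hAu : A = Finset.univ
    · subst hAu
      refine ⟨i, h₁.trans_eq ?_⟩
      exact (sep_pairFamily_top h3 hR₁).symm
    · have hAR : A ∉ R.parts := by
        intro hAR
        have hAF : A ∈ pairFamily R R :=
          mem_pairFamily.2 (Or.inr ⟨Or.inl hAR, hF.one_lt_card A hA⟩)
        rw [laminarContraction_of_mem hF hF' (pairFamily_subset Q₁ R) hAF] at hAtop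
        exact hAu (congrArg Subtype.val hAtop)
      have hAQ : A ∈ Q₁.parts :=
        ((mem_pairFamily.1 hA).resolve_left hAu).1.resolve_right hAR
      -- A block of `R` inside `A` is not a block of `Q₁`, so by tightness it is one of `Q₂`.
      have hQR : ∀ a ∈ A, ∀ b, rel Q₂ a b → rel R a b := by
        intro a ha
        refine (hR a).resolve_left fun hQ => hAR ?_
        have : R.part a = A := by
          ext b
          rw [← rel_iff_mem]
          exact ⟨fun hb => mem_of_rel hAQ ha (hR₁ hb), fun hb => hQ b (rel_of_mem hAQ ha hb)⟩
        exact this ▸ part_mem_parts R a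
      refine ⟨j, h₂.trans fun a b hab => ?_⟩
      refine (sep_laminarTree hF ⟨A, hA⟩).2 ?_
      by_cases he : a = b
      · exact Or.inl he
      right
      by_cases ha : a ∈ A
      · have hr := hQR a ha b hab
        have hsub : R.part a ⊆ A := fun c hc => mem_of_rel hAQ ha (hR₁ (rel_iff_mem.2 hc))
        refine Or.inr ⟨⟨R.part a, mem_pairFamily.2 (Or.inr ⟨Or.inr (part_mem_parts R a),
          one_lt_card_part he hr⟩)⟩, hsub.ssubset_of_ne fun h => hAR (h ▸ part_mem_parts R a),
          mem_part_self R a, rel_iff_mem.1 hr⟩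
      · refine Or.inl ⟨ha, fun hb => ha ?_⟩
        exact mem_of_rel hAQ hb (hR₁ (hQR b hb a ((rel Q₂).symm hab)))
  obtain ⟨l, hl⟩ := mem_union_atomic.1 hmem
  rw [sep_center] at hl
  exact ⟨l, le_iff.2 hl⟩

theorem isExtremal_union_atomic_iff {ι : Type*} {P : ι → SetPartition n}
    (hnd : ∀ i, NonDiscrete (rel (P i))) :
    IsExtremal (union fun i => atomic (P i)) ↔ IsTightClosed P :=
  ⟨isTightClosed_of_isExtremal, fun h => h.isExtremal hnd⟩

theorem BasicPartition.hasThree (P : BasicPartition n) : HasThree (rel P.1) :=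
  three_le_card_iff.1 P.2.1

theorem BasicPartition.nonDiscrete (P : BasicPartition n) : NonDiscrete (rel P.1) :=
  (card_le_pred_iff P.2.1).1 P.2.2

theorem BasicPartition.isAtomicAssignment (P : BasicPartition n) :
    IsAtomicAssignment (atomic P.1) :=
  ⟨_, _, isBasicPair_star P.hasThree P.nonDiscrete,
    isAtomicOf_atomic P.nonDiscrete (sep_center P.hasThree)⟩

/-- The basic partition of a vertex of a tree with more than one internal vertex. -/
noncomputable def basicPart (G : StableTree n) (v : G.V) (h : Nontrivial G.V) :
    BasicPartition n :=
  ⟨setPart G v, three_le_card_setPart G v, card_setPart_le h⟩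

theorem isAtomicOf_basicPart (G : StableTree n) (v : G.V) (h : Nontrivial G.V) :
    IsAtomicOf (atomic (basicPart G v h).1) G v :=
  isAtomicOf_atomic (basicPart G v h).nonDiscrete (rel_setPart G v).symm

/-- The centre of the star of `P` tests whether `P` is coarser than a given partition, so `atomic P`
determines `P`; surjectivity is uniqueness of least elements. -/
theorem atomic_bijective : Function.Bijective fun P : BasicPartition n =>
    (⟨atomic P.1, P.isAtomicAssignment⟩ : {Z : Assignment n // IsAtomicAssignment Z}) := by
  constructor
  · have key : ∀ P P' : BasicPartition n, atomic P.1 = atomic P'.1 → rel P'.1 ≤ rel P.1 := by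
      intro P P' h
      have hc : center P.1 P.hasThree ∈ atomic P.1 (star P.1 P.hasThree) :=
        (sep_center P.hasThree).ge
      rw [h, mem_atomic, sep_center] at hc
      exact hc
    intro P P' h
    have h' : atomic P.1 = atomic P'.1 := congrArg Subtype.val h
    exact Subtype.ext (rel_injective (le_antisymm (key P' P h'.symm) (key P P' h')))
  · rintro ⟨Z, G, v, hG, hZ⟩
    exact ⟨basicPart G v hG.1, Subtype.ext ((isAtomicOf_basicPart G v hG.1).unique hZ)⟩

theorem IsExtremal.nontrivial {Z : Assignment n} (hZ : IsExtremal Z) {G : StableTree n} {v : G.V}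
    (hv : v ∈ Z G) : Nontrivial G.V := by
  by_contra h
  rw [not_nontrivial_iff_subsingleton] at h
  exact hZ.ne_univ G (Set.eq_univ_of_forall fun w => Subsingleton.elim v w ▸ hv)

/-- Take all `P` whose star has its centre in `Z`; there are only finitely many set partitions. -/
theorem IsExtremal.exists_eq_union {Z : Assignment n} (hZ : IsExtremal Z) :
    ∃ (k : ℕ) (P : Fin k → BasicPartition n), Z = union fun i => atomic (P i).1 := by
  obtain ⟨k, ⟨e⟩⟩ := Finite.exists_equiv_fin
    {P : BasicPartition n | center P.1 P.hasThree ∈ Z (star P.1 P.hasThree)}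
  refine ⟨k, fun i => (e.symm i).1, ?_⟩
  funext G
  ext v
  rw [mem_union_atomic]
  constructor
  · intro hv
    let P := basicPart G v (hZ.nontrivial hv)
    have hP : rel P.1 = sep G {v} := rel_setPart G v
    refine ⟨e ⟨P, (hZ.mem_iff_center P.hasThree hP.symm).1 hv⟩, ?_⟩
    change rel (e.symm (e ⟨P, _⟩)).1.1 ≤ _
    rw [Equiv.symm_apply_apply]
    exact hP.le
  · rintro ⟨i, hi⟩
    exact hZ.mem_of_sep_le ((sep_center _).trans_le hi) (e.symm i).2

end Extremal

end ExtremalAssignment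

theorem theorem1p1 (n : ℕ) :
    -- (1) the correspondence, through basic pairs and explicitly
    ∃ e : BasicPartition n ≃ {Z : Assignment n // IsAtomicAssignment Z},
      (∀ P : BasicPartition n, ∃ (G : StableTree n) (v : G.V),
        IsBasicPair G v ∧ IsPartitionOf P.1 G v) ∧
      (∀ (G : StableTree n) (v : G.V), IsBasicPair G v →
        ∃ P : BasicPartition n, IsPartitionOf P.1 G v ∧ IsAtomicOf (e P).1 G v) ∧
      (∀ P : BasicPartition n,
        (e P).1 = union (fun Q : {Q : SetPartition n // CurlyLe Q P.1 ∧ 3 ≤ Q.parts.card} =>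
          generated Q.1)) ∧
      -- (2) extremal assignments are finite unions of atomic ones
      (∀ Z : Assignment n, IsExtremal Z →
        ∃ (k : ℕ) (Y : Fin k → Assignment n), (∀ i, IsAtomicAssignment (Y i)) ∧ Z = union Y) ∧
      -- (3) the criterion for a union of atomic assignments to be extremal
      (∀ (k : ℕ) (P : Fin k → BasicPartition n),
        IsExtremal (union (fun i => (e (P i)).1)) ↔
          ∀ (i j : Fin k) (Q₁ Q₂ R : SetPartition n),
            CurlyLe Q₁ (P i).1 → CurlyLe Q₂ (P j).1 → IsTightUpperBound Q₁ Q₂ R →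
              ∃ l : Fin k, Le R (P l).1) := by
  refine ⟨Equiv.ofBijective _ atomic_bijective,
    fun P => ⟨_, _, isBasicPair_star P.hasThree P.nonDiscrete,
      isPartitionOf_center P.hasThree P.nonDiscrete⟩,
    fun G v hG => ⟨basicPart G v hG.1, isPartitionOf_setPart hG, isAtomicOf_basicPart G v hG.1⟩,
    fun P => atomic_eq_union P.nonDiscrete, fun Z hZ => ?_,
    fun k P => isExtremal_union_atomic_iff fun i => (P i).nonDiscrete⟩
  obtain ⟨k, P, h⟩ := hZ.exists_eq_union
  exact ⟨k, fun i => atomic (P i).1, fun i => (P i).isAtomicAssignment, h⟩
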